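/- **Conventions.** $\mathbb H$ is the skew field of real quaternions; $\mathbf A^*$ is the conjugate transpose; $\operatorname{rk}$ is the rank of a quaternion matrix (the dimension of its right column space); $\operatorname{Ind}\mathbf V$ is the smallest positive integer $k$ with $\operatorname{rk}\mathbf V^{k+1}=\operatorname{rk}\mathbf V^{k}$. For $\mathbf A\in\mathbb H^{m\times n}$ and $\mathbf W\in\mathbb H^{n\times m}$, $\mathbf A^\dagger$ is the Moore–Penrose inverse of $\mathbf A$ (the unique $\mathbf X$ with $\mathbf A\mathbf X\mathbf A=\mathbf A$, $\mathbf X\mathbf A\mathbf X=\mathbf X$, $(\mathbf A\mathbf X)^*=\mathbf A\mathbf X$, $(\mathbf X\mathbf A)^*=\mathbf X\mathbf A$), and $\mathbf A^{d,W}$ is the $W$-weighted Drazin inverse (the unique $\mathbf X$ with $(\mathbf A\mathbf W)^{p+1}\mathbf X\mathbf W=(\mathbf A\mathbf W)^{p}$, $\mathbf X\mathbf W\mathbf A\mathbf W\mathbf X=\mathbf X$, $\mathbf A\mathbf W\mathbf X=\mathbf X\mathbf W\mathbf A$, where $p=\operatorname{Ind}(\mathbf A\mathbf W)$). The $W$-weighted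 MPD inverse of $\mathbf A$ is $\mathbf A^{\dagger,d,W}=\mathbf A^\dagger\mathbf A\mathbf W\mathbf A^{d,W}\mathbf W\in\mathbb H^{n\times m}$. For a quaternion matrix $\mathbf B=(b_{pq})$ with rows and columns indexed by a finite linearly ordered set of $N$ elements, and an index $j$, the $j$-th column determinant $\operatorname{cdet}_j\mathbf B$ is the sum over all permutations $\sigma$ of the indices of $(-1)^{N-c}$ ($c$ being the number of cycles of $\sigma$, fixed points included) times the ordered product of the cycle factors $b_{i\,\sigma^{l}(i)}\cdots b_{\sigma^2(i)\,\sigma(i)}\,b_{\sigma(i)\,i}$, one for each cycle ($l+1$ being its length), where the cycle through $j$ stands rightmost and is written with $i=j$, every other cycle is written with $i$ its least element, and these least elements increase from right to left. If $\mathbf B$ is Hermitian, all $\operatorname{cdet}_j\mathbf B$ coincide, and $|\mathbf B|$ denotes their common value (the empty determinant is $1$). $J_{r,n}$ is the set of $r$-element subsets of $\{1,\dots,n\}$ and $J_{r,n}\{i\}$ the set of those containing $i$; $\mathbf M_\beta^\beta$ is the principal submatrix with rows and columns in $\beta$ (with the original labels of its rows and columns) and $|\mathbf M|_\beta^\beta$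 its determinant when $\mathbf M$ is Hermitian; $\mathbf M_{.i}(\mathbf b)$ is $\mathbf M$ with its $i$-th column replaced by $\mathbf b$. **Theorem.** Let $\mathbf A\in\mathbb H^{m\times n}$ with $\operatorname{rk}\mathbf A=r$, let $\mathbf W\in\mathbb H^{n\times m}$ be nonzero, and put $\mathbf V=\mathbf A\mathbf W$, $k=\max\{\operatorname{Ind}(\mathbf W\mathbf A),\operatorname{Ind}(\mathbf A\mathbf W)\}$ and $r_1=\operatorname{rk}(\mathbf A\mathbf W)^k$. Then the entries of $\mathbf A^{\dagger,d,W}=(a^{\dagger,d,W}_{ij})$ are given as follows. (i) For arbitrary $\mathbf A\mathbf W$, $$a^{\dagger,d,W}_{ij}=\frac{\sum_{\beta\in J_{r,n}\{i\}}\operatorname{cdet}_i\big((\mathbf A^*\mathbf A)_{.i}(\widetilde{\boldsymbol\upsilon}_{.j})\big)_\beta^\beta}{\sum_{\beta\in J_{r,n}}|\mathbf A^*\mathbf A|_\beta^\beta\,\Big(\sum_{\beta\in J_{r_1,m}}\big|(\mathbf V^{2k+1})^*\mathbf V^{2k+1}\big|_\beta^\beta\Big)^2},$$ where $\widetilde{\boldsymbol\upsilon}_{.j}$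 is the $j$-th column of $\widetilde{\boldsymbol\Upsilon}=\mathbf A^*(\mathbf A\mathbf W)^{k+1}\boldsymbol\Upsilon$, the matrix $\boldsymbol\Upsilon=(\upsilon_{tj})\in\mathbb H^{m\times m}$ is $$\upsilon_{tj}=\sum_{\beta\in J_{r_1,m}\{t\}}\operatorname{cdet}_t\Big(\big((\mathbf V^{2k+1})^*\mathbf V^{2k+1}\big)_{.t}(\widehat{\boldsymbol\psi}_{.j})\Big)_\beta^\beta,$$ $\widehat{\boldsymbol\psi}_{.j}$ is the $j$-th column of $\widehat{\boldsymbol\Psi}=(\mathbf V^{2k+1})^*\mathbf V^{2k}\boldsymbol\Psi\mathbf A\mathbf W\in\mathbb H^{m\times m}$, the matrix $\boldsymbol\Psi=(\psi_{sl})\in\mathbb H^{m\times m}$ is $$\psi_{sl}=\sum_{\beta\in J_{r_1,m}\{s\}}\operatorname{cdet}_s\Big(\big((\mathbf V^{2k+1})^*\mathbf V^{2k+1}\big)_{.s}(\hat{\mathbf v}_{.l})\Big)_\beta^\beta,$$ and $\hat{\mathbf v}_{.l}$ is the $l$-th column of $(\mathbf V^{2k+1})^*\mathbf V^{k}$. (ii)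 If $\mathbf A\mathbf W$ is Hermitian, then also $$a^{\dagger,d,W}_{ij}=\frac{\sum_{\beta\in J_{r,n}\{i\}}\operatorname{cdet}_i\big((\mathbf A^*\mathbf A)_{.i}(\widetilde{\boldsymbol\upsilon}_{.j})\big)_\beta^\beta}{\sum_{\beta\in J_{r,n}}|\mathbf A^*\mathbf A|_\beta^\beta\;\sum_{\beta\in J_{r_1,m}}\big|(\mathbf A\mathbf W)^{k+2}\big|_\beta^\beta},$$ where $\widetilde{\boldsymbol\upsilon}_{.j}$ is the $j$-th column of $\widetilde{\boldsymbol\Upsilon}=\mathbf A^*\mathbf A\mathbf W\boldsymbol\Upsilon$, the matrix $\boldsymbol\Upsilon=(\upsilon_{sj})\in\mathbb H^{m\times m}$ is $$\upsilon_{sj}=\sum_{\beta\in J_{r_1,m}\{s\}}\operatorname{cdet}_s\big((\mathbf A\mathbf W)^{k+2}_{.s}(\widetilde{\mathbf v}_{.j})\big)_\beta^\beta,$$ and $\widetilde{\mathbf v}_{.j}$ is the $j$-th column of $(\mathbf A\mathbf W)^{k+1}$. -/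

import Mathlib

open scoped Quaternion Matrix

namespace QMat

/-! ### Rank, index and generalized inverses of quaternion matrices -/

/-- The rank of a quaternion matrix: the dimension of its right column space, that is, of the
right `ℍ`-span of its columns (right scalar multiplication is the action of `ℍᵐᵒᵖ`). -/
noncomputable def rank {m n : ℕ} (A : Matrix (Fin m) (Fin n) ℍ[ℝ]) : ℕ :=
  Module.finrank (ℍ[ℝ])ᵐᵒᵖ (Submodule.span (ℍ[ℝ])ᵐᵒᵖ (Set.range Aᵀ))

/-- The index of a square quaternion matrix: the smallest positive `k` with
`rank (V ^ (k + 1)) = rank (V ^ k)` (such a `k` exists, see `index_spec`). -/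
noncomputable def index {n : ℕ} (V : Matrix (Fin n) (Fin n) ℍ[ℝ]) : ℕ :=
  sInf {k : ℕ | 0 < k ∧ rank (V ^ (k + 1)) = rank (V ^ k)}

/-- The four Penrose equations. -/
structure IsMoorePenrose {m n : ℕ} (A : Matrix (Fin m) (Fin n) ℍ[ℝ])
    (X : Matrix (Fin n) (Fin m) ℍ[ℝ]) : Prop where
  mul_mul_left : A * X * A = A
  mul_mul_right : X * A * X = X
  left_hermitian : (A * X)ᴴ = A * X
  right_hermitian : (X * A)ᴴ = X * A

/-- The equations of the `W`-weighted Drazin inverse of `A`. -/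
structure IsWeightedDrazin {m n : ℕ} (A : Matrix (Fin m) (Fin n) ℍ[ℝ])
    (W : Matrix (Fin n) (Fin m) ℍ[ℝ]) (X : Matrix (Fin m) (Fin n) ℍ[ℝ]) : Prop where
  pow_mul : (A * W) ^ (index (A * W) + 1) * X * W = (A * W) ^ index (A * W)
  mul_mul : X * W * A * W * X = X
  comm : A * W * X = X * W * A

/-! ### Existence and uniqueness of these inverses -/

theorem exists_mul_of_span_le {m n p : ℕ} {A : Matrix (Fin m) (Fin n) ℍ[ℝ]}
    {B : Matrix (Fin m) (Fin p) ℍ[ℝ]}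
    (h : Submodule.span (ℍ[ℝ])ᵐᵒᵖ (Set.range Aᵀ) ≤ Submodule.span (ℍ[ℝ])ᵐᵒᵖ (Set.range Bᵀ)) :
    ∃ Z : Matrix (Fin p) (Fin n) ℍ[ℝ], A = B * Z := by
  have h1 : ∀ j, ∃ c : Fin p → (ℍ[ℝ])ᵐᵒᵖ, ∑ l, c l • Bᵀ l = Aᵀ j := fun j =>
    (Submodule.mem_span_range_iff_exists_fun _).1 (h (Submodule.subset_span ⟨j, rfl⟩))
  choose c hc using h1
  refine ⟨Matrix.of fun l j => (c j l).unop, ?_⟩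
  ext1 i j
  have := congrFun (hc j) i
  simpa [Matrix.mul_apply, Finset.sum_apply] using this.symm

theorem span_mul_le {m n p : ℕ} (B : Matrix (Fin m) (Fin p) ℍ[ℝ])
    (Z : Matrix (Fin p) (Fin n) ℍ[ℝ]) :
    Submodule.span (ℍ[ℝ])ᵐᵒᵖ (Set.range (B * Z)ᵀ) ≤
      Submodule.span (ℍ[ℝ])ᵐᵒᵖ (Set.range Bᵀ) := by
  rw [Submodule.span_le]
  rintro _ ⟨j, rfl⟩
  refine (Submodule.mem_span_range_iff_exists_fun _).2 ⟨fun l => MulOpposite.op (Z l j), ?_⟩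
  ext1 i
  simp [Matrix.mul_apply, Finset.sum_apply]

instance : Module.Finite (ℍ[ℝ])ᵐᵒᵖ ℍ[ℝ] :=
  Module.Finite.of_surjective
    ({ toFun := fun x => x.unop
       map_add' := fun _ _ => rfl
       map_smul' := fun _ _ => rfl } : (ℍ[ℝ])ᵐᵒᵖ →ₗ[(ℍ[ℝ])ᵐᵒᵖ] ℍ[ℝ])
    MulOpposite.unop_surjective

theorem rank_mul_le {m n p : ℕ} (B : Matrix (Fin m) (Fin p) ℍ[ℝ])
    (Z : Matrix (Fin p) (Fin n) ℍ[ℝ]) : rank (B * Z) ≤ rank B :=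
  Submodule.finrank_mono (span_mul_le B Z)

theorem exists_mul_of_rank_eq {m n p : ℕ} (B : Matrix (Fin m) (Fin p) ℍ[ℝ])
    (Z : Matrix (Fin p) (Fin n) ℍ[ℝ]) (h : rank (B * Z) = rank B) :
    ∃ Y : Matrix (Fin n) (Fin p) ℍ[ℝ], B = B * Z * Y :=
  exists_mul_of_span_le (Submodule.eq_of_le_of_finrank_eq (span_mul_le B Z) h).ge

theorem index_spec {n : ℕ} (V : Matrix (Fin n) (Fin n) ℍ[ℝ]) :
    0 < index V ∧ rank (V ^ (index V + 1)) = rank (V ^ index V) := by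
  have hne : {k : ℕ | 0 < k ∧ rank (V ^ (k + 1)) = rank (V ^ k)}.Nonempty := by
    by_contra hcon
    have hlt : ∀ k, rank (V ^ (k + 2)) < rank (V ^ (k + 1)) := fun k => by
      refine lt_of_le_of_ne (by rw [pow_succ V (k + 1)]; exact rank_mul_le _ _) fun he => ?_
      exact hcon ⟨k + 1, Nat.succ_pos k, he⟩
    have hb : ∀ k, rank (V ^ (k + 1)) + k ≤ rank (V ^ 1) := fun k => by
      induction k with
      | zero => simp
      | succ k ih => have := hlt k; rw [show k + 1 + 1 = k + 2 from rfl]; omega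
    have := hb (rank (V ^ 1) + 1)
    omega
  exact Nat.sInf_mem hne

theorem exists_pow_eq_pow_succ_mul {n : ℕ} (V : Matrix (Fin n) (Fin n) ℍ[ℝ]) :
    ∃ Z : Matrix (Fin n) (Fin n) ℍ[ℝ], V ^ index V = V ^ (index V + 1) * Z := by
  have h := (index_spec V).2
  rw [pow_succ] at h ⊢
  exact exists_mul_of_rank_eq _ _ h

theorem pow_eq_pow_add_mul_pow {R : Type*} [Ring R] {v z : R} {a : ℕ} (h : v ^ a = v ^ (a + 1) * z)
    (j : ℕ) : v ^ a = v ^ (a + j) * z ^ j := by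
  induction j with
  | zero => simp
  | succ j ih =>
    have h2 : v ^ (a + j) = v ^ (a + (j + 1)) * z := by
      rw [add_comm a j, pow_add, h, ← mul_assoc, ← pow_add]; congr 2; omega
    calc v ^ a = v ^ (a + j) * z ^ j := ih
      _ = v ^ (a + (j + 1)) * z * z ^ j := by rw [← h2]
      _ = v ^ (a + (j + 1)) * z ^ (j + 1) := by rw [mul_assoc, ← pow_succ']

theorem pow_eq_pow_mul_pow_add {R : Type*} [Ring R] {v z : R} {a : ℕ} (h : v ^ a = z * v ^ (a + 1))
    (j : ℕ) : v ^ a = z ^ j * v ^ (a + j) := by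
  induction j with
  | zero => simp
  | succ j ih =>
    have h2 : v ^ (a + j) = z * v ^ (a + (j + 1)) := by
      rw [pow_add, h, mul_assoc, ← pow_add]; congr 2; omega
    calc v ^ a = z ^ j * v ^ (a + j) := ih
      _ = z ^ j * (z * v ^ (a + (j + 1))) := by rw [← h2]
      _ = z ^ (j + 1) * v ^ (a + (j + 1)) := by rw [← mul_assoc, ← pow_succ]

theorem exists_drazin_of_ring {R : Type*} [Ring R] {v y z : R} {a b : ℕ}
    (hz : v ^ a = v ^ (a + 1) * z) (hy : v ^ b = y * v ^ (b + 1)) :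
    ∃ d, v ^ (a + 1) * d = v ^ a ∧ d * v * d = d ∧ v * d = d * v := by
  -- a common exponent `N`
  obtain ⟨N, hzN, hyN⟩ : ∃ N, v ^ N = v ^ (N + 1) * z ∧ v ^ N = y * v ^ (N + 1) := by
    refine ⟨a + b, ?_, ?_⟩
    · rw [add_comm a b, pow_add, hz, ← mul_assoc, ← pow_add]; rfl
    · rw [add_comm a b, pow_add, hy, mul_assoc, ← pow_add]; congr 2; omega
  have h1 := pow_eq_pow_add_mul_pow hzN
  have h2 := pow_eq_pow_mul_pow_add hyN
  -- `d = v ^ N * z ^ (N + 1) = y ^ (N + 1) * v ^ N`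
  have hd : v ^ N * z ^ (N + 1) = y ^ (N + 1) * v ^ N := by
    calc v ^ N * z ^ (N + 1) = y ^ (N + 1) * v ^ (N + (N + 1)) * z ^ (N + 1) := by
          rw [← h2]
      _ = y ^ (N + 1) * v ^ N := by rw [mul_assoc, ← h1]
  have e1 : v * (v ^ N * z ^ (N + 1)) = v ^ N * z ^ N := by
    rw [← mul_assoc, ← pow_succ', pow_succ' z, ← mul_assoc, ← hzN]
  have e2 : y ^ (N + 1) * v ^ N * v = y ^ N * v ^ N := by
    rw [mul_assoc, ← pow_succ, pow_succ y, mul_assoc, ← hyN]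
  have e3 : v ^ N * z ^ N = y ^ N * v ^ N := by
    calc v ^ N * z ^ N = y ^ N * v ^ (N + N) * z ^ N := by rw [← h2]
      _ = y ^ N * v ^ N := by rw [mul_assoc, ← h1]
  have hcomm : v * (v ^ N * z ^ (N + 1)) = v ^ N * z ^ (N + 1) * v := by
    rw [e1, e3, ← e2, ← hd]
  have hN : v ^ N * (v ^ N * z ^ N) = v ^ N := by
    rw [← mul_assoc, ← pow_add, ← h1]
  refine ⟨v ^ N * z ^ (N + 1), ?_, ?_, hcomm⟩
  · -- `v ^ a` is `v ^ (a + N)` times a power of `z`, and `v * d` commutes with `v`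
    have hc : Commute (v * (v ^ N * z ^ (N + 1))) v := by
      have hc0 : Commute v (v ^ N * z ^ (N + 1)) := hcomm
      exact ((Commute.refl v).mul_right hc0).symm
    have h3 := pow_eq_pow_add_mul_pow hz N
    have h4 : v * (v ^ N * z ^ (N + 1)) * v ^ N = v ^ N := by
      rw [(hc.pow_right N).eq, e1, hN]
    rw [pow_succ, mul_assoc, ← (hc.pow_right a).eq]
    calc v * (v ^ N * z ^ (N + 1)) * v ^ a
        = v * (v ^ N * z ^ (N + 1)) * (v ^ (N + a) * z ^ N) := by
          rw [add_comm N a, ← h3]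
      _ = v * (v ^ N * z ^ (N + 1)) * v ^ N * (v ^ a * z ^ N) := by
          rw [pow_add v N a, mul_assoc (v * (v ^ N * z ^ (N + 1))) (v ^ N), mul_assoc (v ^ N)]
      _ = v ^ a := by rw [h4, ← mul_assoc, ← pow_add, add_comm N a, ← h3]
  · rw [← hcomm, e1, e3, mul_assoc]
    rw [← mul_assoc (v ^ N), ← pow_add]
    calc y ^ N * (v ^ (N + N) * z ^ (N + 1)) = y ^ N * v ^ (N + N) * z ^ (N + 1) := by
          rw [mul_assoc]
      _ = v ^ N * z ^ (N + 1) := by rw [← h2]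

theorem drazin_unique_of_ring {R : Type*} [Ring R] {v x y : R} {k : ℕ}
    (hx1 : v ^ (k + 1) * x = v ^ k) (hx2 : Commute v x) (hx3 : x * v * x = x)
    (hy1 : v ^ (k + 1) * y = v ^ k) (hy2 : Commute v y) (hy3 : y * v * y = y) : x = y := by
  have key : ∀ {x y : R}, Commute v x → x * v * x = x → v ^ (k + 1) * y = v ^ k → Commute v y →
      v * x = v * x * (v * y) ∧ v * x = v * y * (v * x) := by
    intro x y hx2 hx3 hy1 hy2
    have hi : IsIdempotentElem (v * x) := by
      change v * x * (v * x) = v * x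
      rw [mul_assoc, ← mul_assoc x, hx3]
    have hp : v * x = v ^ (k + 1) * x ^ (k + 1) := by
      rw [← hx2.mul_pow, hi.pow_succ_eq]
    have hp' : v * x = x ^ (k + 1) * v ^ (k + 1) := by
      rw [hp, (hx2.pow_pow _ _).eq]
    have h1 : v ^ (k + 1) * (v * y) = v ^ (k + 1) := by
      rw [hy2.eq, ← mul_assoc, hy1, ← pow_succ]
    have h2 : v * y * v ^ (k + 1) = v ^ (k + 1) := by
      have : Commute (v * y) v := ((Commute.refl v).mul_right hy2).symm
      rw [(this.pow_right _).eq, h1]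
    constructor
    · rw [hp', mul_assoc, h1]
    · rw [hp, ← mul_assoc, h2]
  have hxy : v * x = v * y := (key hx2 hx3 hy1 hy2).1.trans (key hy2 hy3 hx1 hx2).2.symm
  calc x = x * (v * x) := by rw [← mul_assoc, hx3]
    _ = x * v * y := by rw [hxy, mul_assoc]
    _ = y * v * y := by rw [← hx2.eq, hxy, hy2.eq]
    _ = y := hy3

/-- Every square quaternion matrix has a Drazin inverse. -/
theorem exists_drazin {n : ℕ} (V : Matrix (Fin n) (Fin n) ℍ[ℝ]) :
    ∃ D : Matrix (Fin n) (Fin n) ℍ[ℝ],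
      V ^ (index V + 1) * D = V ^ index V ∧ D * V * D = D ∧ V * D = D * V := by
  obtain ⟨Z, hZ⟩ := exists_pow_eq_pow_succ_mul V
  obtain ⟨Y, hY⟩ := exists_pow_eq_pow_succ_mul Vᴴ
  refine exists_drazin_of_ring hZ (y := Yᴴ) (b := index Vᴴ) ?_
  have := congrArg Matrix.conjTranspose hY
  simpa only [Matrix.conjTranspose_mul, ← Matrix.conjTranspose_pow,
    Matrix.conjTranspose_conjTranspose] using this

theorem exists_isWeightedDrazin {m n : ℕ} (A : Matrix (Fin m) (Fin n) ℍ[ℝ])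
    (W : Matrix (Fin n) (Fin m) ℍ[ℝ]) : ∃ X, IsWeightedDrazin A W X := by
  obtain ⟨D, h1, h2, h3⟩ := exists_drazin (A * W)
  have h4 : D * D * (A * W) = D := by rw [mul_assoc, ← h3, ← mul_assoc, h2]
  have h4' : D * D * A * W = D := by rw [Matrix.mul_assoc, h4]
  refine ⟨D * D * A, ?_, ?_, ?_⟩
  · rw [Matrix.mul_assoc, h4', h1]
  · rw [h4', Matrix.mul_assoc D A W, ← Matrix.mul_assoc, ← Matrix.mul_assoc, h2]
  · rw [h4', ← Matrix.mul_assoc, ← Matrix.mul_assoc, h3, h2]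

theorem IsWeightedDrazin.unique {m n : ℕ} {A : Matrix (Fin m) (Fin n) ℍ[ℝ]}
    {W : Matrix (Fin n) (Fin m) ℍ[ℝ]} {X Y : Matrix (Fin m) (Fin n) ℍ[ℝ]}
    (hX : IsWeightedDrazin A W X) (hY : IsWeightedDrazin A W Y) : X = Y := by
  -- `X * W` and `Y * W` are both the Drazin inverse of `A * W`
  have key : ∀ {X : Matrix (Fin m) (Fin n) ℍ[ℝ]}, IsWeightedDrazin A W X →
      (A * W) ^ (index (A * W) + 1) * (X * W) = (A * W) ^ index (A * W) ∧
      Commute (A * W) (X * W) ∧ X * W * (A * W) * (X * W) = X * W ∧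
      X = X * W * (X * W) * A := by
    intro X h
    have hc : A * W * (X * W) = X * W * (A * W) := by
      rw [← Matrix.mul_assoc, h.comm, Matrix.mul_assoc (X * W)]
    refine ⟨by rw [← Matrix.mul_assoc, h.pow_mul], hc, ?_, ?_⟩
    · rw [← Matrix.mul_assoc (X * W) A W, ← Matrix.mul_assoc _ X W, h.mul_mul]
    · conv_lhs => rw [← h.mul_mul, Matrix.mul_assoc (X * W), Matrix.mul_assoc (X * W), h.comm,
        ← Matrix.mul_assoc]
  obtain ⟨a1, a2, a3, a4⟩ := key hX
  obtain ⟨b1, b2, b3, b4⟩ := key hY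
  have hXY : X * W = Y * W := by
    exact drazin_unique_of_ring a1 a2 a3 b1 b2 b3
  rw [a4, b4, hXY]

theorem eq_zero_of_conjTranspose_mul_self {m n : ℕ} {B : Matrix (Fin m) (Fin n) ℍ[ℝ]}
    (h : Bᴴ * B = 0) : B = 0 := by
  ext1 i j
  have h1 : ∑ l, star (B l j) * B l j = 0 := by
    simpa [Matrix.mul_apply] using congrFun (congrFun h j) j
  have h2 : ∑ l, Quaternion.normSq (B l j) = 0 := by
    apply (algebraMap ℝ ℍ[ℝ]).injective
    rw [map_sum, map_zero, ← h1]
    exact Finset.sum_congr rfl fun l _ => (Quaternion.star_mul_self _).symm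
  have h3 := (Finset.sum_eq_zero_iff_of_nonneg fun l _ => Quaternion.normSq_nonneg).1 h2 i
    (Finset.mem_univ i)
  exact Quaternion.normSq_eq_zero.1 h3

theorem mul_eq_zero_of_conjTranspose_mul {m n p : ℕ} {B : Matrix (Fin m) (Fin n) ℍ[ℝ]}
    {M : Matrix (Fin n) (Fin p) ℍ[ℝ]} (h : Bᴴ * (B * M) = 0) : B * M = 0 := by
  apply eq_zero_of_conjTranspose_mul_self
  rw [Matrix.conjTranspose_mul, Matrix.mul_assoc, h, Matrix.mul_zero]

theorem exists_mul_conjTranspose_mul_self {m n : ℕ} (A : Matrix (Fin m) (Fin n) ℍ[ℝ]) :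
    ∃ Z : Matrix (Fin m) (Fin n) ℍ[ℝ], A = A * Aᴴ * Z := by
  obtain ⟨G, hG⟩ : ∃ G, G = A * Aᴴ := ⟨_, rfl⟩
  have hGs : Gᴴ = G := by rw [hG, Matrix.conjTranspose_mul, Matrix.conjTranspose_conjTranspose]
  obtain ⟨D, h1, -, h3⟩ := exists_drazin G
  have hpow : ∀ k : ℕ, G ^ (k + 1) * (1 - G * D) = 0 → G * (1 - G * D) = 0 := by
    intro k
    induction k with
    | zero => intro h; simpa using h
    | succ k ih =>
      intro h
      refine ih ?_
      rw [pow_succ', Matrix.mul_assoc]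
      apply mul_eq_zero_of_conjTranspose_mul
      rw [hGs, ← Matrix.mul_assoc, ← Matrix.mul_assoc, mul_assoc G, ← pow_succ', ← pow_succ', h]
  have h4 : G * (1 - G * D) = 0 := by
    apply hpow (index G)
    rw [mul_sub, mul_one, pow_succ', mul_assoc, ← mul_assoc (G ^ _), ← pow_succ, h1, sub_self]
  have h5 : Aᴴ * (1 - G * D) = 0 := by
    apply mul_eq_zero_of_conjTranspose_mul
    rw [Matrix.conjTranspose_conjTranspose, ← Matrix.mul_assoc, ← hG, h4]
  have h6 := congrArg Matrix.conjTranspose h5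
  rw [h3, Matrix.conjTranspose_mul, Matrix.conjTranspose_conjTranspose, Matrix.conjTranspose_sub,
    Matrix.conjTranspose_one, Matrix.conjTranspose_mul, hGs, Matrix.conjTranspose_zero,
    Matrix.sub_mul, Matrix.one_mul, sub_eq_zero] at h6
  exact ⟨Dᴴ * A, by rw [← hG, ← Matrix.mul_assoc]; exact h6⟩

theorem exists_isMoorePenrose {m n : ℕ} (A : Matrix (Fin m) (Fin n) ℍ[ℝ]) :
    ∃ X, IsMoorePenrose A X := by
  obtain ⟨Z, hZ⟩ := exists_mul_conjTranspose_mul_self A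
  obtain ⟨Y, hY⟩ := exists_mul_conjTranspose_mul_self Aᴴ
  rw [Matrix.conjTranspose_conjTranspose] at hY
  -- `P = Aᴴ * Z` and `Q = A * Y` are the two orthogonal projectors
  have hP : (Aᴴ * Z)ᴴ = Aᴴ * Z := by
    have : Aᴴ * Z = (Aᴴ * Z)ᴴ * (Aᴴ * Z) := by
      conv_lhs => rw [hZ]
      simp only [Matrix.conjTranspose_mul, Matrix.conjTranspose_conjTranspose, Matrix.mul_assoc]
    rw [this]
    simp only [Matrix.conjTranspose_mul, Matrix.conjTranspose_conjTranspose]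
  have hQ : (A * Y)ᴴ = A * Y := by
    have : A * Y = (A * Y)ᴴ * (A * Y) := by
      conv_lhs => rw [← Matrix.conjTranspose_conjTranspose A, hY]
      simp only [Matrix.conjTranspose_mul, Matrix.conjTranspose_conjTranspose, Matrix.mul_assoc]
    rw [this]
    simp only [Matrix.conjTranspose_mul, Matrix.conjTranspose_conjTranspose]
  have hAP : A * (Aᴴ * Z) = A := by rw [← Matrix.mul_assoc, ← hZ]
  have hP' : Zᴴ * A = Aᴴ * Z := by
    rw [← hP, Matrix.conjTranspose_mul, Matrix.conjTranspose_conjTranspose]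
  have hQA : A * Y * A = A := by
    have := congrArg Matrix.conjTranspose hY
    rwa [Matrix.conjTranspose_mul, Matrix.conjTranspose_mul, Matrix.conjTranspose_conjTranspose,
      ← Matrix.mul_assoc, ← Matrix.conjTranspose_conjTranspose A, ← Matrix.conjTranspose_mul,
      Matrix.conjTranspose_conjTranspose, hQ, eq_comm] at this
  have hAX : A * (Zᴴ * A * Y) = A * Y := by rw [hP', ← Matrix.mul_assoc, hAP]
  have hXA : Zᴴ * A * Y * A = Aᴴ * Z := by
    rw [Matrix.mul_assoc, Matrix.mul_assoc, ← Matrix.mul_assoc A, hQA, hP']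
  refine ⟨Zᴴ * A * Y, ?_, ?_, ?_, ?_⟩
  · rw [hAX, hQA]
  · rw [hXA, ← hP', Matrix.mul_assoc, hAX, ← Matrix.mul_assoc]
  · rw [hAX, hQ]
  · rw [hXA, hP]

theorem IsMoorePenrose.unique {m n : ℕ} {A : Matrix (Fin m) (Fin n) ℍ[ℝ]}
    {X Y : Matrix (Fin n) (Fin m) ℍ[ℝ]}
    (hX : IsMoorePenrose A X) (hY : IsMoorePenrose A Y) : X = Y := by
  have h1 : A * X = A * Y := by
    calc A * X = (A * X)ᴴ := hX.left_hermitian.symm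
      _ = ((A * Y) * (A * X))ᴴ := by rw [← Matrix.mul_assoc, hY.mul_mul_left]
      _ = A * X * (A * Y) := by
          rw [Matrix.conjTranspose_mul, hX.left_hermitian, hY.left_hermitian]
      _ = A * Y := by rw [← Matrix.mul_assoc, hX.mul_mul_left]
  have h2 : X * A = Y * A := by
    calc X * A = (X * A)ᴴ := hX.right_hermitian.symm
      _ = ((X * A) * (Y * A))ᴴ := by
          rw [Matrix.mul_assoc, ← Matrix.mul_assoc A, hY.mul_mul_left]
      _ = Y * A * (X * A) := by
          rw [Matrix.conjTranspose_mul, hX.right_hermitian, hY.right_hermitian]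
      _ = Y * A := by rw [Matrix.mul_assoc, ← Matrix.mul_assoc A, hX.mul_mul_left]
  rw [← hX.mul_mul_right, h2, Matrix.mul_assoc, h1, ← Matrix.mul_assoc, hY.mul_mul_right]

/-- The Moore-Penrose inverse `A^†`, the unique solution of the Penrose equations. -/
noncomputable def mpInv {m n : ℕ} (A : Matrix (Fin m) (Fin n) ℍ[ℝ]) :
    Matrix (Fin n) (Fin m) ℍ[ℝ] :=
  (exists_isMoorePenrose A).choose

/-- The `W`-weighted Drazin inverse `A^{d,W}`, the unique solution of its defining equations. -/
noncomputable def wDrazinInv {m n : ℕ} (A : Matrix (Fin m) (Fin n) ℍ[ℝ])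
    (W : Matrix (Fin n) (Fin m) ℍ[ℝ]) : Matrix (Fin m) (Fin n) ℍ[ℝ] :=
  (exists_isWeightedDrazin A W).choose

/-- The `W`-weighted MPD inverse `A^{†,d,W} = A^† A W A^{d,W} W`. -/
noncomputable def wmpdInv {m n : ℕ} (A : Matrix (Fin m) (Fin n) ℍ[ℝ])
    (W : Matrix (Fin n) (Fin m) ℍ[ℝ]) : Matrix (Fin n) (Fin m) ℍ[ℝ] :=
  mpInv A * A * W * wDrazinInv A W * W

/-! ### Column determinants -/

section Cdet

variable {ι : Type*} [Fintype ι] [LinearOrder ι]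

/-- The factor of a column determinant that belongs to the cycle of `σ` through `c`, written from
right to left starting at `c`: `a (c, σ^l c) ⋯ a (σ² c, σ c) a (σ c, c)`, where `l + 1` is the
length of the cycle (for a fixed point it is `a (c, c)`). -/
noncomputable def cycleFactor (A : Matrix ι ι ℍ[ℝ]) (σ : Equiv.Perm ι) (c : ι) : ℍ[ℝ] :=
  ((List.range (Function.minimalPeriod σ c)).map
    fun t => A ((σ ^ (t + 1)) c) ((σ ^ t) c)).reverse.prod

open Classical in
/-- The least elements of the cycles of `σ` (fixed points included) not passing through `j`, listed
in decreasing order. -/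
noncomputable def cycleHeads (σ : Equiv.Perm ι) (j : ι) : List ι :=
  (Finset.univ.filter fun c => ¬ σ.SameCycle j c ∧ ∀ d, σ.SameCycle c d → c ≤ d).sort (· ≥ ·)

/-- The `j`-th column determinant of a quaternion matrix. In the term of `σ` the cycle through `j`
stands rightmost and starts (from the right) with `j`; each other cycle starts from the right with
its least element, and these least elements increase from right to left. With `r` cycles in all,
fixed points included, the sign `(-1)^(n-r)` is the sign of `σ`. -/
noncomputable def cdet (A : Matrix ι ι ℍ[ℝ]) (j : ι) : ℍ[ℝ] :=
  ∑ σ : Equiv.Perm ι, Equiv.Perm.sign σ •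
    (((cycleHeads σ j).map (cycleFactor A σ)).prod * cycleFactor A σ j)

end Cdet

/-- The principal submatrix `M_β^β`. -/
def principal {n : ℕ} (M : Matrix (Fin n) (Fin n) ℍ[ℝ]) (β : Finset (Fin n)) :
    Matrix β β ℍ[ℝ] :=
  M.submatrix (fun x => (x : Fin n)) (fun x => (x : Fin n))

/-- The principal minor `|M|_β^β` of a Hermitian matrix `M`. All column determinants of a Hermitian
matrix coincide, and this common value is its determinant; we take the column determinant along
the first column. The empty minor is `1`. -/
noncomputable def principalMinor {n : ℕ} (M : Matrix (Fin n) (Fin n) ℍ[ℝ])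
    (β : Finset (Fin n)) : ℍ[ℝ] :=
  if h : β.Nonempty then cdet (principal M β) ⟨β.min' h, β.min'_mem h⟩ else 1

/-- The sum `∑_{β ∈ J_{r,n}} |M|_β^β` of the principal minors of order `r` of a Hermitian
matrix. -/
noncomputable def minorSum {n : ℕ} (r : ℕ) (M : Matrix (Fin n) (Fin n) ℍ[ℝ]) : ℍ[ℝ] :=
  ∑ β : {β : Finset (Fin n) // β.card = r}, principalMinor M β.1

/-- The matrix whose `(i, j)` entry is `∑_{β ∈ J_{r,n}{i}} cdet_i ((M_{.i}(b_{.j}))_β^β)`, where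
`M_{.i}(b_{.j})` is `M` with its `i`-th column replaced by the `j`-th column of `B`, and
`J_{r,n}{i}` is the set of the `r`-element sets of indices that contain `i`. -/
noncomputable def cdetSum {n p : ℕ} (r : ℕ) (M : Matrix (Fin n) (Fin n) ℍ[ℝ])
    (B : Matrix (Fin n) (Fin p) ℍ[ℝ]) : Matrix (Fin n) (Fin p) ℍ[ℝ] :=
  Matrix.of fun i j => ∑ β : {β : Finset (Fin n) // β.card = r ∧ i ∈ β},
    cdet (principal (M.updateCol i fun l => B l j) β.1) ⟨i, β.2.2⟩

end QMat

/-!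
Expanding a column determinant along a replaced column defines a cofactor matrix. For a Hermitian
`M` this matrix is Hermitian and a left adjugate of `M`: this is an induction on the index set, in
which expansions along two columns `p`, `s` are compared through the entry `M p s`; they agree where
it is nonzero, and elsewhere by continuity. Summing the adjugates of all principal submatrices of a
given order yields the Faddeev–LeVerrier recursion, and its traces identify `rank M` as the largest
order for which the sum of principal minors does not vanish. At that order the recursion becomes a
Cramer rule: applied to `Aᴴ * A` it gives `A†`, and applied to the normal equations of
`V ^ (2 * k + 1)`, or to `V ^ (k + 2)` when `V` is Hermitian, it gives the Drazin inverse of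
`V = A * W`, which is the `W`-weighted Drazin inverse of `A` times `W`.
-/

namespace QMat

/-! ### Cycles of permutations -/

section Cycles

variable {ι : Type*}

theorem isPeriodicPt_iff_pow_apply {σ : Equiv.Perm ι} {t : ℕ} {c : ι} :
    Function.IsPeriodicPt σ t c ↔ (σ ^ t) c = c := by
  rw [Function.IsPeriodicPt, Function.IsFixedPt, Equiv.Perm.iterate_eq_pow]

theorem pow_minimalPeriod_apply (σ : Equiv.Perm ι) (c : ι) :
    (σ ^ Function.minimalPeriod σ c) c = c :=
  isPeriodicPt_iff_pow_apply.1 (Function.isPeriodicPt_minimalPeriod σ c)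

theorem pow_apply_ne_of_lt {σ : Equiv.Perm ι} {c : ι} {s t : ℕ} (hst : s < t)
    (ht : t < Function.minimalPeriod σ c) : (σ ^ s) c ≠ (σ ^ t) c := by
  simp only [← Equiv.Perm.iterate_eq_pow]
  exact fun h => hst.ne (Function.iterate_injOn_Iio_minimalPeriod (hst.trans ht) ht h)

theorem minimalPeriod_perm_pos [Finite ι] (σ : Equiv.Perm ι) (c : ι) :
    0 < Function.minimalPeriod σ c :=
  Function.minimalPeriod_pos_of_mem_periodicPts (σ.injective.mem_periodicPts c)

theorem sameCycle_iff_exists_lt_minimalPeriod [Finite ι] {σ : Equiv.Perm ι} {c d : ι} :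
    σ.SameCycle c d ↔ ∃ t < Function.minimalPeriod σ c, (σ ^ t) c = d := by
  refine ⟨fun h => ?_, fun ⟨t, _, ht⟩ => ⟨t, by simpa using ht⟩⟩
  obtain ⟨t, rfl⟩ := h.exists_nat_pow_eq
  refine ⟨t % _, Nat.mod_lt t (minimalPeriod_perm_pos σ c), ?_⟩
  rw [← Equiv.Perm.iterate_eq_pow, Function.iterate_mod_minimalPeriod_eq,
    Equiv.Perm.iterate_eq_pow]

theorem exists_minimalPeriod_eq_add_two [Finite ι] {σ : Equiv.Perm ι} {p : ι}
    (hp : σ p ≠ p) :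
    ∃ l, Function.minimalPeriod σ p = l + 2 := by
  have hpos := minimalPeriod_perm_pos σ p
  have hne : Function.minimalPeriod σ p ≠ 1 := fun h =>
    hp (Function.minimalPeriod_eq_one_iff_isFixedPt.1 h)
  exact ⟨_, (Nat.sub_add_cancel (by lia)).symm⟩

section PermsOfFinset

variable [DecidableEq ι] {β : Finset ι} {σ : Equiv.Perm ι}

theorem mem_permsOfFinset_iff_forall_notMem :
    σ ∈ permsOfFinset β ↔ ∀ x ∉ β, σ x = x := by
  rw [mem_perms_of_finset_iff]
  exact forall_congr' fun x => not_imp_comm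

theorem mem_of_sameCycle (hσ : σ ∈ permsOfFinset β) {c d : ι} (hc : c ∈ β)
    (h : σ.SameCycle c d) : d ∈ β := by
  by_contra hd
  exact hd (h.symm.eq_of_left (mem_permsOfFinset_iff_forall_notMem.1 hσ d hd) ▸ hc)

theorem sum_ofSubtype {A : Type*} [AddCommMonoid A] (β : Finset ι) (f : Equiv.Perm ι → A) :
    ∑ σ : Equiv.Perm β, f (Equiv.Perm.ofSubtype σ) = ∑ σ ∈ permsOfFinset β, f σ := by
  let _ := Fintype.ofEquiv _ (Equiv.Perm.subtypeEquivSubtypePerm (· ∈ β))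
  rw [Finset.sum_subtype (permsOfFinset β) (fun _ => mem_permsOfFinset_iff_forall_notMem)]
  exact Fintype.sum_equiv (Equiv.Perm.subtypeEquivSubtypePerm (· ∈ β)) _ _ fun σ => rfl

theorem ofSubtype_mem_permsOfFinset (σ : Equiv.Perm β) :
    Equiv.Perm.ofSubtype σ ∈ permsOfFinset β :=
  mem_permsOfFinset_iff_forall_notMem.2 fun _ => Equiv.Perm.ofSubtype_apply_of_not_mem σ

theorem pow_ofSubtype_apply_coe (σ : Equiv.Perm β) (t : ℕ) (c : β) :
    (Equiv.Perm.ofSubtype σ ^ t) (c : ι) = ((σ ^ t) c : β) := by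
  rw [← map_pow, Equiv.Perm.ofSubtype_apply_coe]

theorem sameCycle_ofSubtype (σ : Equiv.Perm β) (c d : β) :
    (Equiv.Perm.ofSubtype σ).SameCycle (c : ι) d ↔ σ.SameCycle c d := by
  simp only [Equiv.Perm.SameCycle, ← map_zpow, Equiv.Perm.ofSubtype_apply_coe, Subtype.ext_iff]

theorem minimalPeriod_ofSubtype (σ : Equiv.Perm β) (c : β) :
    Function.minimalPeriod (Equiv.Perm.ofSubtype σ) (c : ι) = Function.minimalPeriod σ c := by
  simp only [Function.minimalPeriod_eq_minimalPeriod_iff, isPeriodicPt_iff_pow_apply,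
    pow_ofSubtype_apply_coe, Subtype.ext_iff, implies_true]

end PermsOfFinset

section Swap

variable [DecidableEq ι] {σ : Equiv.Perm ι} {p c : ι}

theorem pow_mul_swap_apply_of_not_sameCycle (hc : ¬ σ.SameCycle p c) (t : ℕ) :
    ((σ * Equiv.swap p (σ p)) ^ t) c = (σ ^ t) c := by
  induction t with
  | zero => rfl
  | succ t ih =>
    have hsc : ¬ σ.SameCycle p ((σ ^ t) c) := Equiv.Perm.sameCycle_pow_right.not.2 hc
    have hp : (σ ^ t) c ≠ p := fun h => hsc (h ▸ .refl _ _)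
    have hq : (σ ^ t) c ≠ σ p := fun h => hsc (h ▸ Equiv.Perm.sameCycle_apply_right.2 (.refl _ _))
    rw [pow_succ', Equiv.Perm.mul_apply, ih, Equiv.Perm.mul_apply,
      Equiv.swap_apply_of_ne_of_ne hp hq, pow_succ', Equiv.Perm.mul_apply]

theorem minimalPeriod_mul_swap_of_not_sameCycle (hc : ¬ σ.SameCycle p c) :
    Function.minimalPeriod (σ * Equiv.swap p (σ p)) c = Function.minimalPeriod σ c := by
  simp only [Function.minimalPeriod_eq_minimalPeriod_iff, isPeriodicPt_iff_pow_apply,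
    pow_mul_swap_apply_of_not_sameCycle hc, implies_true]

theorem sameCycle_mul_swap_of_not_sameCycle [Finite ι] (hc : ¬ σ.SameCycle p c) (d : ι) :
    (σ * Equiv.swap p (σ p)).SameCycle c d ↔ σ.SameCycle c d := by
  simp only [sameCycle_iff_exists_lt_minimalPeriod, minimalPeriod_mul_swap_of_not_sameCycle hc,
    pow_mul_swap_apply_of_not_sameCycle hc]

theorem pow_succ_mul_swap_apply_self {t : ℕ} (ht : t + 1 < Function.minimalPeriod σ p) :
    ((σ * Equiv.swap p (σ p)) ^ (t + 1)) p = (σ ^ (t + 2)) p := by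
  induction t with
  | zero => simp [pow_two]
  | succ t ih =>
    have hp : (σ ^ (t + 2)) p ≠ p := (pow_apply_ne_of_lt (s := 0) (by lia) ht).symm
    have hq : (σ ^ (t + 2)) p ≠ σ p := (pow_apply_ne_of_lt (s := 1) (by lia) ht).symm
    rw [pow_succ', Equiv.Perm.mul_apply, ih (by lia), Equiv.Perm.mul_apply,
      Equiv.swap_apply_of_ne_of_ne hp hq, ← Equiv.Perm.mul_apply, ← pow_succ']

theorem minimalPeriod_mul_swap_self [Finite ι] (hp : σ p ≠ p) :
    Function.minimalPeriod (σ * Equiv.swap p (σ p)) p + 1 = Function.minimalPeriod σ p := by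
  obtain ⟨l, hl⟩ := exists_minimalPeriod_eq_add_two hp
  obtain ⟨s, hs⟩ := Nat.exists_eq_succ_of_ne_zero
    (minimalPeriod_perm_pos (σ * Equiv.swap p (σ p)) p).ne'
  have hle : s + 1 ≤ l + 1 := by
    rw [← Nat.succ_eq_add_one, ← hs]
    refine Function.IsPeriodicPt.minimalPeriod_le (Nat.succ_pos l) (isPeriodicPt_iff_pow_apply.2 ?_)
    rw [pow_succ_mul_swap_apply_self (by lia), ← hl, pow_minimalPeriod_apply]
  have hreturn : (σ ^ (s + 2)) p = p := by
    rw [← pow_succ_mul_swap_apply_self (by lia), ← Nat.succ_eq_add_one, ← hs,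
      pow_minimalPeriod_apply]
  have hge : ¬ s < l := fun h =>
    pow_apply_ne_of_lt (s := 0) (by lia) (by lia : s + 2 < Function.minimalPeriod σ p) hreturn.symm
  lia

theorem sameCycle_iff_eq_or_sameCycle_mul_swap [Finite ι] :
    σ.SameCycle p c ↔ c = σ p ∨ (σ * Equiv.swap p (σ p)).SameCycle p c := by
  constructor
  · intro h
    obtain ⟨t, ht, rfl⟩ := sameCycle_iff_exists_lt_minimalPeriod.1 h
    match t with
    | 0 => exact Or.inr (.refl _ _)
    | 1 => exact Or.inl (by rw [pow_one])
    | t + 2 =>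
      rw [← pow_succ_mul_swap_apply_self (by lia)]
      exact Or.inr (Equiv.Perm.sameCycle_pow_right.2 (.refl _ _))
  · rintro (rfl | h)
    · exact Equiv.Perm.sameCycle_apply_right.2 (.refl _ _)
    · by_contra hc
      exact hc ((sameCycle_mul_swap_of_not_sameCycle hc p).1 h.symm).symm

theorem mul_swap_mem_permsOfFinset_erase {β : Finset ι} (hσ : σ ∈ permsOfFinset β) (hp : p ∈ β) :
    σ * Equiv.swap p (σ p) ∈ permsOfFinset (β.erase (σ p)) := by
  rw [mem_permsOfFinset_iff_forall_notMem] at hσ ⊢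
  intro x hx
  rcases eq_or_ne x (σ p) with rfl | hxq
  · simp
  · have hxβ : x ∉ β := fun h => hx (Finset.mem_erase.2 ⟨hxq, h⟩)
    rw [Equiv.Perm.mul_apply,
      Equiv.swap_apply_of_ne_of_ne (ne_of_mem_of_not_mem hp hxβ).symm hxq, hσ x hxβ]

theorem mul_swap_mem_permsOfFinset {β : Finset ι} (hσ : σ ∈ permsOfFinset β) (hp : p ∈ β) {q : ι}
    (hq : q ∈ β) : σ * Equiv.swap p q ∈ permsOfFinset β := by
  rw [mem_permsOfFinset_iff_forall_notMem] at hσ ⊢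
  intro x hx
  rw [Equiv.Perm.mul_apply, Equiv.swap_apply_of_ne_of_ne (ne_of_mem_of_not_mem hp hx).symm
    (ne_of_mem_of_not_mem hq hx).symm, hσ x hx]

end Swap

end Cycles

/-! ### Cofactors -/

section CycleTail

variable {ι : Type*}

/-- The cycle factor of `c` without its rightmost entry `M (σ c) c`. -/
noncomputable def cycleTail (M : Matrix ι ι ℍ[ℝ]) (σ : Equiv.Perm ι) (c : ι) : ℍ[ℝ] :=
  ((List.range (Function.minimalPeriod σ c - 1)).map
    fun t => M ((σ ^ (t + 2)) c) ((σ ^ (t + 1)) c)).reverse.prod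

theorem cycleFactor_eq_cycleTail_mul [Finite ι] (M : Matrix ι ι ℍ[ℝ]) (σ : Equiv.Perm ι) (c : ι) :
    cycleFactor M σ c = cycleTail M σ c * M (σ c) c := by
  obtain ⟨l, hl⟩ := Nat.exists_eq_succ_of_ne_zero (minimalPeriod_perm_pos σ c).ne'
  simp [cycleFactor, cycleTail, hl, List.range_succ_eq_map, Function.comp_def]

theorem cycleTail_of_apply_eq_self (M : Matrix ι ι ℍ[ℝ]) {σ : Equiv.Perm ι} {p : ι}
    (hp : σ p = p) : cycleTail M σ p = 1 := by
  simp [cycleTail, Function.minimalPeriod_eq_one_iff_isFixedPt.2 hp]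

theorem cycleTail_updateCol [DecidableEq ι] (M : Matrix ι ι ℍ[ℝ]) (σ : Equiv.Perm ι) (p : ι)
    (b : ι → ℍ[ℝ]) :
    cycleTail (M.updateCol p b) σ p = cycleTail M σ p := by
  rw [cycleTail, cycleTail]
  congr 2
  refine List.map_congr_left fun t ht => Matrix.updateCol_ne ?_
  rw [List.mem_range] at ht
  exact (pow_apply_ne_of_lt (s := 0) (Nat.succ_pos t) (by lia)).symm

theorem cycleTail_eq_cycleTail_mul_swap_mul [Finite ι] [DecidableEq ι] (M : Matrix ι ι ℍ[ℝ])
    {σ : Equiv.Perm ι} {p : ι} (hp : σ p ≠ p) : cycleTail M σ p =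
      cycleTail M (σ * Equiv.swap p (σ p)) p * M ((σ * Equiv.swap p (σ p)) p) (σ p) := by
  have hperiod := minimalPeriod_mul_swap_self hp
  obtain ⟨l, hl⟩ := exists_minimalPeriod_eq_add_two hp
  rw [cycleTail, cycleTail,
    show Function.minimalPeriod (σ * Equiv.swap p (σ p)) p - 1 = l by lia,
    show Function.minimalPeriod σ p - 1 = l + 1 by lia, List.range_succ_eq_map, List.map_cons,
    List.reverse_cons, List.prod_append, List.map_map]
  congr 1
  · congr 2
    refine List.map_congr_left fun t ht => ?_
    rw [List.mem_range] at ht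
    rw [pow_succ_mul_swap_apply_self (by lia), pow_succ_mul_swap_apply_self (by lia)]
    rfl
  · simp [pow_two]

theorem continuous_cycleFactor (σ : Equiv.Perm ι) (c : ι) :
    Continuous fun M : Matrix ι ι ℍ[ℝ] => cycleFactor M σ c := by
  simp only [cycleFactor, ← List.map_reverse]
  exact continuous_list_prod _ fun t _ => by fun_prop

theorem continuous_cycleTail (σ : Equiv.Perm ι) (c : ι) :
    Continuous fun M : Matrix ι ι ℍ[ℝ] => cycleTail M σ c := by
  simp only [cycleTail, ← List.map_reverse]
  exact continuous_list_prod _ fun t _ => by fun_prop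

end CycleTail

section CycleProd

variable {ι : Type*} [LinearOrder ι]

open Classical in
/-- The least elements of the cycles of `σ` contained in `β`. -/
noncomputable def cycleMins (β : Finset ι) (σ : Equiv.Perm ι) : Finset ι :=
  {c ∈ β | ∀ d, σ.SameCycle c d → c ≤ d}

open Classical in
/-- The least elements of the cycles of `σ` in `β` that do not pass through `p`. -/
noncomputable def cycleMinsOff (β : Finset ι) (σ : Equiv.Perm ι) (p : ι) : Finset ι :=
  {c ∈ cycleMins β σ | ¬ σ.SameCycle p c}

/-- The product of the cycle factors with starting points in `s`, which increase from right to
left as in `cdet`. -/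
noncomputable def cycleProd (M : Matrix ι ι ℍ[ℝ]) (σ : Equiv.Perm ι) (s : Finset ι) : ℍ[ℝ] :=
  ((s.sort (· ≥ ·)).map (cycleFactor M σ)).prod

theorem mem_cycleMins {β : Finset ι} {σ : Equiv.Perm ι} {c : ι} :
    c ∈ cycleMins β σ ↔ c ∈ β ∧ ∀ d, σ.SameCycle c d → c ≤ d := by
  simp only [cycleMins, Finset.mem_filter]

theorem mem_cycleMinsOff {β : Finset ι} {σ : Equiv.Perm ι} {p c : ι} :
    c ∈ cycleMinsOff β σ p ↔ c ∈ cycleMins β σ ∧ ¬ σ.SameCycle p c := by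
  simp only [cycleMinsOff, Finset.mem_filter]

theorem cycleMins_eq_insert {β : Finset ι} {σ : Equiv.Perm ι} (hσ : σ ∈ permsOfFinset β) {p : ι}
    (hp : p ∈ β) (hmin : ∀ x ∈ β, p ≤ x) : cycleMins β σ = insert p (cycleMinsOff β σ p) := by
  ext c
  rw [Finset.mem_insert, mem_cycleMinsOff, mem_cycleMins]
  constructor
  · rintro ⟨hc, h⟩
    by_cases hpc : σ.SameCycle p c
    · exact Or.inl (le_antisymm (h p hpc.symm) (hmin c hc))
    · exact Or.inr ⟨⟨hc, h⟩, hpc⟩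
  · rintro (rfl | ⟨h, -⟩)
    · exact ⟨hp, fun d hd => hmin d (mem_of_sameCycle hσ hp hd)⟩
    · exact h

theorem cycleMinsOff_of_apply_eq_self (β : Finset ι) {σ : Equiv.Perm ι} {p : ι} (hp : σ p = p) :
    cycleMinsOff β σ p = cycleMins (β.erase p) σ := by
  have hsc (c : ι) : σ.SameCycle p c ↔ c = p :=
    ⟨fun h => (h.eq_of_left hp).symm, fun h => h ▸ .refl _ _⟩
  ext c
  rw [mem_cycleMinsOff, mem_cycleMins, mem_cycleMins, Finset.mem_erase, hsc]
  tauto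

theorem cycleMinsOff_mul_swap [Finite ι] (β : Finset ι) (σ : Equiv.Perm ι) (p : ι) :
    cycleMinsOff (β.erase (σ p)) (σ * Equiv.swap p (σ p)) p = cycleMinsOff β σ p := by
  ext c
  simp only [mem_cycleMinsOff, mem_cycleMins, Finset.mem_erase]
  by_cases hc : σ.SameCycle p c
  · have := sameCycle_iff_eq_or_sameCycle_mul_swap.1 hc
    tauto
  · have := sameCycle_iff_eq_or_sameCycle_mul_swap.not.1 hc
    simp only [sameCycle_mul_swap_of_not_sameCycle hc]
    tauto

theorem sort_ge_insert {s : Finset ι} {a : ι} (h : ∀ b ∈ s, a < b) :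
    (insert a s).sort (· ≥ ·) = s.sort (· ≥ ·) ++ [a] := by
  refine List.Perm.eq_of_pairwise' (r := (· ≥ ·)) (Finset.pairwise_sort _ _) ?_ ?_
  · refine List.pairwise_append.2
      ⟨Finset.pairwise_sort _ _, List.pairwise_singleton _ _, fun b hb c hc => ?_⟩
    rw [List.mem_singleton.1 hc]
    exact (h b ((Finset.mem_sort _).1 hb)).le
  · rw [← Multiset.coe_eq_coe, Finset.sort_eq,
      Finset.insert_val_of_notMem fun ha => (h a ha).false, ← Multiset.coe_add, Finset.sort_eq,
      Multiset.coe_singleton, add_comm, Multiset.singleton_add]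

theorem cycleProd_cycleMins (M : Matrix ι ι ℍ[ℝ]) {β : Finset ι} {σ : Equiv.Perm ι}
    (hσ : σ ∈ permsOfFinset β) {p : ι} (hp : p ∈ β) (hmin : ∀ x ∈ β, p ≤ x) :
    cycleProd M σ (cycleMins β σ) =
      cycleProd M σ (cycleMinsOff β σ p) * cycleFactor M σ p := by
  have hlt : ∀ c ∈ cycleMinsOff β σ p, p < c := fun c hc => by
    rw [mem_cycleMinsOff, mem_cycleMins] at hc
    refine lt_of_le_of_ne (hmin c hc.1.1) fun h => hc.2 (h ▸ .refl _ _)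
  simp [cycleProd, cycleMins_eq_insert hσ hp hmin, sort_ge_insert hlt]

theorem cycleProd_congr {M M' : Matrix ι ι ℍ[ℝ]} {σ τ : Equiv.Perm ι} {s : Finset ι}
    (h : ∀ c ∈ s, cycleFactor M σ c = cycleFactor M' τ c) :
    cycleProd M σ s = cycleProd M' τ s :=
  congrArg List.prod (List.map_congr_left fun c hc => h c ((Finset.mem_sort _).1 hc))

theorem cycleProd_updateCol (M : Matrix ι ι ℍ[ℝ]) (β : Finset ι) (σ : Equiv.Perm ι) (p : ι)
    (b : ι → ℍ[ℝ]) :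
    cycleProd (M.updateCol p b) σ (cycleMinsOff β σ p) =
      cycleProd M σ (cycleMinsOff β σ p) := by
  refine cycleProd_congr fun c hc => ?_
  rw [cycleFactor, cycleFactor]
  congr 2
  refine List.map_congr_left fun t _ => Matrix.updateCol_ne fun h => (mem_cycleMinsOff.1 hc).2 ?_
  exact h ▸ Equiv.Perm.sameCycle_pow_left.2 (.refl _ _)

theorem continuous_cycleProd (σ : Equiv.Perm ι) (s : Finset ι) :
    Continuous fun M : Matrix ι ι ℍ[ℝ] => cycleProd M σ s :=
  continuous_list_prod _ fun c _ => continuous_cycleFactor σ c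

theorem cycleProd_mul_swap [Finite ι] (M : Matrix ι ι ℍ[ℝ]) (β : Finset ι) (σ : Equiv.Perm ι)
    (p : ι) :
    cycleProd M (σ * Equiv.swap p (σ p))
        (cycleMinsOff (β.erase (σ p)) (σ * Equiv.swap p (σ p)) p) =
      cycleProd M σ (cycleMinsOff β σ p) := by
  rw [cycleMinsOff_mul_swap]
  refine cycleProd_congr fun c hc => ?_
  rw [mem_cycleMinsOff] at hc
  simp only [cycleFactor, minimalPeriod_mul_swap_of_not_sameCycle hc.2,
    pow_mul_swap_apply_of_not_sameCycle hc.2]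

end CycleProd

section Cofactor

variable {ι : Type*} [Fintype ι] [LinearOrder ι]

/-- The matrix of the cofactors of the principal submatrix of `M` on `β`, extended by zero outside
`β × β`: the `(p, q)` entry is the coefficient of `b q` in the `p`-th column determinant of that
submatrix with its `p`-th column replaced by `b`. For a Hermitian matrix it is the adjugate. -/
noncomputable def cofactor (M : Matrix ι ι ℍ[ℝ]) (β : Finset ι) : Matrix ι ι ℍ[ℝ] :=
  Matrix.of fun p q => ∑ σ ∈ permsOfFinset β with p ∈ β ∧ σ p = q,
    Equiv.Perm.sign σ • (cycleProd M σ (cycleMinsOff β σ p) * cycleTail M σ p)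

theorem cofactor_apply_of_notMem_left (M : Matrix ι ι ℍ[ℝ]) {β : Finset ι} {p : ι} (hp : p ∉ β)
    (q : ι) : cofactor M β p q = 0 := by
  simp [cofactor, hp]

theorem cofactor_apply_of_notMem_right (M : Matrix ι ι ℍ[ℝ]) {β : Finset ι} (p : ι) {q : ι}
    (hq : q ∉ β) : cofactor M β p q = 0 := by
  rw [cofactor, Matrix.of_apply, Finset.filter_false_of_mem, Finset.sum_empty]
  rintro σ hσ ⟨hp, rfl⟩
  exact hq (mem_of_sameCycle hσ hp (Equiv.Perm.sameCycle_apply_right.2 (.refl _ _)))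

theorem cofactor_mulVec_apply (M : Matrix ι ι ℍ[ℝ]) {β : Finset ι} {p : ι} (hp : p ∈ β)
    (b : ι → ℍ[ℝ]) : (cofactor M β *ᵥ b) p = ∑ σ ∈ permsOfFinset β, Equiv.Perm.sign σ •
      (cycleProd M σ (cycleMinsOff β σ p) * (cycleTail M σ p * b (σ p))) := by
  rw [← Finset.sum_fiberwise _ (fun σ => σ p), Matrix.mulVec, dotProduct]
  refine Finset.sum_congr rfl fun q _ => ?_
  simp only [cofactor, Matrix.of_apply, hp, true_and, Finset.sum_mul]
  refine Finset.sum_congr rfl fun σ hσ => ?_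
  rw [(Finset.mem_filter.1 hσ).2, smul_mul_assoc, mul_assoc]

theorem cofactor_mul_apply_of_notMem {κ : Type*} (M : Matrix ι ι ℍ[ℝ]) (B : Matrix ι κ ℍ[ℝ])
    {β : Finset ι} {p : ι} (hp : p ∉ β) (j : κ) : (cofactor M β * B) p j = 0 := by
  simp [Matrix.mul_apply, cofactor_apply_of_notMem_left M hp]

/-- Shortening the cycle `p ↦ q ↦ ⋯` to `p ↦ σ q ↦ ⋯` trades a cofactor in column `q` for one of
the principal submatrix without `q`, at the cost of the factor `M (σ q) q` and a sign. -/
theorem cofactor_apply_of_ne (M : Matrix ι ι ℍ[ℝ]) {β : Finset ι} {p q : ι} (hp : p ∈ β)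
    (hq : q ∈ β) (hpq : p ≠ q) :
    cofactor M β p q = -(cofactor M (β.erase q) * M) p q := by
  change _ = -(cofactor M (β.erase q) *ᵥ fun x => M x q) p
  rw [cofactor_mulVec_apply M (Finset.mem_erase.2 ⟨hpq, hp⟩), cofactor, Matrix.of_apply,
    ← Finset.sum_neg_distrib]
  refine Finset.sum_nbij' (· * Equiv.swap p q) (· * Equiv.swap p q) ?_ ?_ ?_ ?_ ?_
  · intro σ hσ
    obtain ⟨hσβ, -, rfl⟩ := Finset.mem_filter.1 hσ
    exact mul_swap_mem_permsOfFinset_erase hσβ hp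
  · intro τ hτ
    have hτq : τ q = q := mem_permsOfFinset_iff_forall_notMem.1 hτ q (Finset.notMem_erase q β)
    have hτβ : τ ∈ permsOfFinset β := mem_perms_of_finset_iff.2 fun hx =>
      Finset.mem_of_mem_erase (mem_perms_of_finset_iff.1 hτ hx)
    exact Finset.mem_filter.2 ⟨mul_swap_mem_permsOfFinset hτβ hp hq, hp, by simp [hτq]⟩
  · intro σ _
    simp [mul_assoc]
  · intro σ _
    simp [mul_assoc]
  · intro σ hσ
    obtain ⟨-, -, rfl⟩ := Finset.mem_filter.1 hσ
    rw [cycleTail_eq_cycleTail_mul_swap_mul M hpq.symm, cycleProd_mul_swap, Equiv.Perm.sign_mul,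
      Equiv.Perm.sign_swap hpq]
    simp [Units.smul_def]

theorem continuous_cofactor (β : Finset ι) :
    Continuous fun M : Matrix ι ι ℍ[ℝ] => cofactor M β := by
  refine continuous_matrix fun p q => ?_
  simp only [cofactor, Matrix.of_apply, Units.smul_def]
  exact continuous_finsetSum _ fun σ _ =>
    ((continuous_cycleProd σ _).mul (continuous_cycleTail σ p)).const_smul _

end Cofactor

section PrincipalMinor

variable {n : ℕ}

theorem cycleFactor_principal (M : Matrix (Fin n) (Fin n) ℍ[ℝ]) {β : Finset (Fin n)}
    (σ : Equiv.Perm β) (c : β) :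
    cycleFactor (principal M β) σ c = cycleFactor M (Equiv.Perm.ofSubtype σ) c := by
  simp only [cycleFactor, minimalPeriod_ofSubtype, pow_ofSubtype_apply_coe, principal,
    Matrix.submatrix_apply]

theorem map_cycleHeads {β : Finset (Fin n)} (σ : Equiv.Perm β) (i : β) :
    (cycleHeads σ i).map ((↑) : β → Fin n) =
      (cycleMinsOff β (Equiv.Perm.ofSubtype σ) i).sort (· ≥ ·) := by
  refine (Finset.map_sort (Function.Embedding.subtype (· ∈ β)) _ (· ≥ ·) (· ≥ ·)
    fun a _ b _ => Iff.rfl).trans (congrArg (Finset.sort · (· ≥ ·)) ?_)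
  ext c
  simp only [Finset.mem_map, Finset.mem_filter, Finset.mem_univ, true_and, mem_cycleMinsOff,
    mem_cycleMins, Function.Embedding.subtype_apply]
  constructor
  · rintro ⟨c, ⟨hoff, hmin⟩, rfl⟩
    refine ⟨⟨c.2, fun d hd => ?_⟩, by rwa [sameCycle_ofSubtype]⟩
    have hdβ := mem_of_sameCycle (ofSubtype_mem_permsOfFinset σ) c.2 hd
    exact hmin ⟨d, hdβ⟩ ((sameCycle_ofSubtype σ c ⟨d, hdβ⟩).1 hd)
  · rintro ⟨⟨hc, hmin⟩, hoff⟩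
    exact ⟨⟨c, hc⟩, ⟨by rwa [← sameCycle_ofSubtype],
      fun d hd => hmin d ((sameCycle_ofSubtype σ ⟨c, hc⟩ d).2 hd)⟩, rfl⟩

theorem cdet_principal (M : Matrix (Fin n) (Fin n) ℍ[ℝ]) (β : Finset (Fin n)) (i : β) :
    cdet (principal M β) i = ∑ σ ∈ permsOfFinset β, Equiv.Perm.sign σ •
      (cycleProd M σ (cycleMinsOff β σ i) * cycleFactor M σ i) := by
  rw [cdet, ← sum_ofSubtype]
  refine Finset.sum_congr rfl fun σ _ => ?_
  rw [Equiv.Perm.sign_ofSubtype, cycleFactor_principal, cycleProd, ← map_cycleHeads, List.map_map]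
  congr 4
  ext1 c
  exact cycleFactor_principal M σ c

theorem cdet_principal_updateCol (M : Matrix (Fin n) (Fin n) ℍ[ℝ]) (β : Finset (Fin n)) (i : β)
    (b : Fin n → ℍ[ℝ]) : cdet (principal (M.updateCol i b) β) i = (cofactor M β *ᵥ b) i := by
  rw [cdet_principal, cofactor_mulVec_apply M i.2]
  refine Finset.sum_congr rfl fun σ _ => ?_
  rw [cycleProd_updateCol, cycleFactor_eq_cycleTail_mul, cycleTail_updateCol,
    Matrix.updateCol_self]

theorem principalMinor_empty (M : Matrix (Fin n) (Fin n) ℍ[ℝ]) : principalMinor M ∅ = 1 := by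
  simp [principalMinor]

theorem principalMinor_eq_cofactor_mul_apply (M : Matrix (Fin n) (Fin n) ℍ[ℝ])
    {β : Finset (Fin n)} (h : β.Nonempty) :
    principalMinor M β = (cofactor M β * M) (β.min' h) (β.min' h) := by
  rw [principalMinor, dif_pos h]
  conv_lhs => rw [← Matrix.updateCol_eq_self M (β.min' h)]
  exact cdet_principal_updateCol M β ⟨β.min' h, β.min'_mem h⟩ _

theorem principalMinor_eq_sum (M : Matrix (Fin n) (Fin n) ℍ[ℝ]) (β : Finset (Fin n)) :
    principalMinor M β =
      ∑ σ ∈ permsOfFinset β, Equiv.Perm.sign σ • cycleProd M σ (cycleMins β σ) := by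
  rcases β.eq_empty_or_nonempty with rfl | h
  · have hperms : permsOfFinset (∅ : Finset (Fin n)) = {1} := by
      ext σ
      simp [mem_permsOfFinset_iff_forall_notMem, Equiv.ext_iff]
    simp [principalMinor_empty, hperms, cycleMins, cycleProd]
  · rw [principalMinor, dif_pos h, cdet_principal]
    refine Finset.sum_congr rfl fun σ hσ => ?_
    rw [cycleProd_cycleMins M hσ (β.min'_mem h) fun x hx => β.min'_le x hx]

theorem cofactor_apply_self (M : Matrix (Fin n) (Fin n) ℍ[ℝ]) {β : Finset (Fin n)} {p : Fin n}
    (hp : p ∈ β) : cofactor M β p p = principalMinor M (β.erase p) := by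
  rw [cofactor, Matrix.of_apply, principalMinor_eq_sum]
  refine Finset.sum_congr ?_ fun σ hσ => ?_
  · ext σ
    simp only [Finset.mem_filter, mem_permsOfFinset_iff_forall_notMem, Finset.mem_erase, not_and_or,
      not_not, hp, true_and]
    exact ⟨fun h x hx => hx.elim (fun e => e ▸ h.2) (h.1 x),
      fun h => ⟨fun x hx => h x (Or.inr hx), h p (Or.inl rfl)⟩⟩
  · have hσp := mem_permsOfFinset_iff_forall_notMem.1 hσ p (Finset.notMem_erase p β)
    rw [cycleMinsOff_of_apply_eq_self β hσp, cycleTail_of_apply_eq_self M hσp, mul_one]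

theorem cofactor_apply_of_mem_right (M : Matrix (Fin n) (Fin n) ℍ[ℝ]) {β : Finset (Fin n)}
    (p : Fin n) {q : Fin n} (hq : q ∈ β) :
    cofactor M β p q =
      (if p = q then principalMinor M (β.erase q) else 0) - (cofactor M (β.erase q) * M) p q := by
  rcases eq_or_ne p q with rfl | hpq
  · rw [cofactor_apply_self M hq, if_pos rfl,
      cofactor_mul_apply_of_notMem M M (Finset.notMem_erase p β), sub_zero]
  by_cases hp : p ∈ β
  · rw [cofactor_apply_of_ne M hp hq hpq, if_neg hpq, zero_sub]
  · rw [cofactor_apply_of_notMem_left M hp, if_neg hpq,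
      cofactor_mul_apply_of_notMem M M fun h => hp (Finset.mem_of_mem_erase h), sub_zero]

end PrincipalMinor

/-! ### Hermitian matrices -/

section Hermitian

theorem commute_of_isSelfAdjoint {a : ℍ[ℝ]} (h : IsSelfAdjoint a) (b : ℍ[ℝ]) : Commute a b := by
  rw [Quaternion.star_eq_self.1 h]
  exact Quaternion.coe_commutes _ b

theorem isSelfAdjoint_mul {a b : ℍ[ℝ]} (ha : IsSelfAdjoint a) (hb : IsSelfAdjoint b) :
    IsSelfAdjoint (a * b) :=
  (ha.commute_iff hb).1 (commute_of_isSelfAdjoint ha b)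

variable {n : ℕ} {M : Matrix (Fin n) (Fin n) ℍ[ℝ]} {β : Finset (Fin n)}

theorem star_cofactor_mul_apply (hM : M.IsHermitian) (hC : (cofactor M β).IsHermitian)
    (p q : Fin n) : star ((cofactor M β * M) p q) = (M * cofactor M β) q p := by
  rw [← Matrix.conjTranspose_apply, Matrix.conjTranspose_mul, hM.eq, hC.eq]

theorem isHermitian_mul_cofactor_mul (hM : M.IsHermitian) (hC : (cofactor M β).IsHermitian) :
    (M * cofactor M β * M).IsHermitian := by
  simpa only [hM.eq] using Matrix.isHermitian_conjTranspose_mul_mul M hC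

theorem cofactor_mul_apply_of_mem_of_isHermitian (hM : M.IsHermitian)
    (hC : (cofactor M β).IsHermitian) {p : Fin n} (hp : p ∈ β)
    (hC' : (cofactor M (β.erase p)).IsHermitian)
    (hD : IsSelfAdjoint (principalMinor M (β.erase p))) (s : Fin n) :
    (cofactor M β * M) p s =
      principalMinor M (β.erase p) * M p s - (M * cofactor M (β.erase p) * M) p s := by
  have hrow (q : Fin n) : cofactor M β p q =
      (if p = q then principalMinor M (β.erase p) else 0) - (M * cofactor M (β.erase p)) p q := by
    rw [← hC.apply, cofactor_apply_of_mem_right M q hp, star_sub,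
      star_cofactor_mul_apply hM hC', apply_ite star, hD.star_eq, star_zero]
    simp only [eq_comm]
  rw [Matrix.mul_apply, Matrix.mul_apply]
  simp only [hrow, sub_mul, ite_mul, zero_mul, Finset.sum_sub_distrib, Finset.sum_ite_eq,
    Finset.mem_univ, if_true]

theorem isHermitian_cofactor_of_forall_ssubset (hM : M.IsHermitian)
    (h : ∀ γ ⊂ β, IsSelfAdjoint (principalMinor M γ) ∧ (cofactor M γ).IsHermitian) :
    (cofactor M β).IsHermitian := by
  have hoff {p q : Fin n} (hp : p ∈ β) (hq : q ∈ β) (hpq : p ≠ q) :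
      cofactor M β p q = (M * cofactor M ((β.erase q).erase p) * M) p q -
        principalMinor M ((β.erase q).erase p) * M p q := by
    have hp' : p ∈ β.erase q := Finset.mem_erase.2 ⟨hpq, hp⟩
    have hq' := h _ (Finset.erase_ssubset hq)
    have hpq' := h _ ((Finset.erase_ssubset hp').trans (Finset.erase_ssubset hq))
    rw [cofactor_apply_of_ne M hp hq hpq,
      cofactor_mul_apply_of_mem_of_isHermitian hM hq'.2 hp' hpq'.2 hpq'.1, neg_sub]
  refine Matrix.IsHermitian.ext fun p q => ?_
  by_cases hp : p ∈ β
  swap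
  · rw [cofactor_apply_of_notMem_left M hp, cofactor_apply_of_notMem_right M q hp, star_zero]
  by_cases hq : q ∈ β
  swap
  · rw [cofactor_apply_of_notMem_left M hq, cofactor_apply_of_notMem_right M p hq, star_zero]
  rcases eq_or_ne p q with rfl | hpq
  · rw [cofactor_apply_self M hp, (h _ (Finset.erase_ssubset hp)).1.star_eq]
  obtain ⟨hD, hC⟩ := h ((β.erase p).erase q) <|
    (Finset.erase_subset _ _).trans_ssubset (Finset.erase_ssubset hp)
  rw [hoff hq hp hpq.symm, hoff hp hq hpq, Finset.erase_right_comm (a := q), star_sub, star_mul,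
    (isHermitian_mul_cofactor_mul hM hC).apply, hM.apply, hD.star_eq,
    (commute_of_isSelfAdjoint hD _).eq]

theorem isSelfAdjoint_cofactor_mul_apply_self (hM : M.IsHermitian)
    (hC : (cofactor M β).IsHermitian) {p : Fin n} (hp : p ∈ β)
    (hC' : (cofactor M (β.erase p)).IsHermitian)
    (hD : IsSelfAdjoint (principalMinor M (β.erase p))) :
    IsSelfAdjoint ((cofactor M β * M) p p) := by
  rw [cofactor_mul_apply_of_mem_of_isHermitian hM hC hp hC' hD]
  exact (isSelfAdjoint_mul hD (hM.apply p p)).sub ((isHermitian_mul_cofactor_mul hM hC').apply p p)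

theorem isSelfAdjoint_principalMinor_and_isHermitian_cofactor (hM : M.IsHermitian)
    (β : Finset (Fin n)) :
    IsSelfAdjoint (principalMinor M β) ∧ (cofactor M β).IsHermitian := by
  induction β using Finset.strongInduction with | _ β ih
  have hC := isHermitian_cofactor_of_forall_ssubset hM ih
  refine ⟨?_, hC⟩
  rcases β.eq_empty_or_nonempty with rfl | h
  · rw [principalMinor_empty]
    exact .one _
  · obtain ⟨hD', hC'⟩ := ih _ (Finset.erase_ssubset (β.min'_mem h))
    rw [principalMinor_eq_cofactor_mul_apply M h]
    exact isSelfAdjoint_cofactor_mul_apply_self hM hC (β.min'_mem h) hC' hD'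

theorem isSelfAdjoint_principalMinor (hM : M.IsHermitian) (β : Finset (Fin n)) :
    IsSelfAdjoint (principalMinor M β) :=
  (isSelfAdjoint_principalMinor_and_isHermitian_cofactor hM β).1

theorem isHermitian_cofactor (hM : M.IsHermitian) (β : Finset (Fin n)) :
    (cofactor M β).IsHermitian :=
  (isSelfAdjoint_principalMinor_and_isHermitian_cofactor hM β).2

/-- The two sides are the column determinants of the principal submatrix on `β` along the columns
`p` and `s`; both can be read off from the `(p, s)` entry of `M * cofactor M β * M`. -/
theorem cofactor_mul_apply_self_eq_of_apply_ne_zero (hM : M.IsHermitian)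
    (hoff : ∀ p ∈ β, ∀ s ∈ β, p ≠ s → (cofactor M β * M) p s = 0) {p s : Fin n} (hp : p ∈ β)
    (hs : s ∈ β) (h : M p s ≠ 0) :
    (cofactor M β * M) p p = (cofactor M β * M) s s := by
  have hC := isHermitian_cofactor hM
  have hcol {s : Fin n} (hs : s ∈ β) (x : Fin n) (hx : x ≠ s) : (cofactor M β * M) x s = 0 := by
    by_cases hxβ : x ∈ β
    · exact hoff x hxβ s hs hx
    · exact cofactor_mul_apply_of_notMem M M hxβ s
  have hleft : (M * cofactor M β * M) p s = M p s * (cofactor M β * M) s s := by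
    rw [Matrix.mul_assoc, Matrix.mul_apply, Finset.sum_eq_single s] <;> simp +contextual [hcol hs]
  have hsa : IsSelfAdjoint ((cofactor M β * M) p p) :=
    isSelfAdjoint_cofactor_mul_apply_self hM (hC _) hp (hC _) (isSelfAdjoint_principalMinor hM _)
  have hright : (M * cofactor M β * M) p s = (cofactor M β * M) p p * M p s := by
    have hrow (x : Fin n) : (M * cofactor M β) p x = star ((cofactor M β * M) x p) :=
      (star_cofactor_mul_apply hM (hC β) x p).symm
    rw [Matrix.mul_apply, Finset.sum_eq_single p, hrow, hsa.star_eq] <;>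
      simp +contextual [hrow, hcol hp]
  rw [hleft, (commute_of_isSelfAdjoint hsa _).eq] at hright
  exact (mul_left_cancel₀ h hright).symm

/-- A Hermitian matrix with `(p, s)` entry `0` is a limit of Hermitian matrices with nonzero
`(p, s)` entry. -/
theorem cofactor_mul_apply_self_eq (hM : M.IsHermitian)
    (hoff : ∀ M : Matrix (Fin n) (Fin n) ℍ[ℝ], M.IsHermitian →
      ∀ p ∈ β, ∀ s ∈ β, p ≠ s → (cofactor M β * M) p s = 0)
    {p s : Fin n} (hp : p ∈ β) (hs : s ∈ β) :
    (cofactor M β * M) p p = (cofactor M β * M) s s := by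
  rcases eq_or_ne p s with rfl | hps
  · rfl
  by_cases h : M p s = 0
  swap
  · exact cofactor_mul_apply_self_eq_of_apply_ne_zero hM (hoff M hM) hp hs h
  let E (ε : ℝ) : Matrix (Fin n) (Fin n) ℍ[ℝ] := Matrix.single p s (ε : ℍ[ℝ])
  let N (ε : ℝ) : Matrix (Fin n) (Fin n) ℍ[ℝ] := M + (E ε + (E ε)ᴴ)
  have hN (ε : ℝ) : (N ε).IsHermitian := hM.add (Matrix.isHermitian_add_transpose_self _)
  have hNps (ε : ℝ) : N ε p s = ε := by simp [N, E, h, hps.symm]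
  have hN0 : N 0 = M := by simp [N, E]
  have hE : Continuous E := continuous_matrix fun i j => by
    simp only [E, Matrix.single_apply]
    split_ifs
    exacts [Quaternion.continuous_coe, continuous_const]
  have hcont : Continuous N := continuous_const.add (hE.add hE.matrix_conjTranspose)
  have hentry (i : Fin n) : Continuous fun ε => (cofactor (N ε) β * N ε) i i :=
    (((continuous_cofactor β).comp hcont).matrix_mul hcont).matrix_elem i i
  have hdense := (hentry p).ext_on (dense_compl_singleton (0 : ℝ)) (hentry s) fun ε hε =>
    cofactor_mul_apply_self_eq_of_apply_ne_zero (hN ε) (hoff _ (hN ε)) hp hs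
      (by rw [hNps]; exact (map_ne_zero (algebraMap ℝ ℍ[ℝ])).2 hε)
  simpa only [hN0] using congrFun hdense 0

theorem cofactor_mul_apply_of_mem (hM : M.IsHermitian) (p : Fin n) {s : Fin n} (hs : s ∈ β) :
    (cofactor M β * M) p s = if p = s then principalMinor M β else 0 := by
  induction β using Finset.strongInduction generalizing M p s with | _ β ih
  have hoff (M : Matrix (Fin n) (Fin n) ℍ[ℝ]) (hM : M.IsHermitian) (p : Fin n) (hp : p ∈ β)
      (s : Fin n) (hs : s ∈ β) (hps : p ≠ s) : (cofactor M β * M) p s = 0 := by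
    have hD := isSelfAdjoint_principalMinor hM (β.erase p)
    rw [cofactor_mul_apply_of_mem_of_isHermitian hM (isHermitian_cofactor hM _) hp
      (isHermitian_cofactor hM _) hD, Matrix.mul_assoc, Matrix.mul_apply]
    simp [ih _ (Finset.erase_ssubset hp) hM _ (Finset.mem_erase.2 ⟨hps.symm, hs⟩),
      (commute_of_isSelfAdjoint hD _).eq]
  split_ifs with hps
  · have hβ : β.Nonempty := ⟨s, hs⟩
    rw [hps, principalMinor_eq_cofactor_mul_apply M hβ]
    exact cofactor_mul_apply_self_eq hM hoff hs (β.min'_mem hβ)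
  · by_cases hp : p ∈ β
    · exact hoff M hM p hp s hs hps
    · exact cofactor_mul_apply_of_notMem M M hp s

end Hermitian

/-! ### Rank and trace -/

section RankTrace

variable {m n p : ℕ}

theorem mpInv_spec (A : Matrix (Fin m) (Fin n) ℍ[ℝ]) : IsMoorePenrose A (mpInv A) :=
  (exists_isMoorePenrose A).choose_spec

theorem exists_left_inverse_of_cancel {X : Matrix (Fin m) (Fin n) ℍ[ℝ]}
    (h : ∀ C : Matrix (Fin n) (Fin n) ℍ[ℝ], X * C = 0 → C = 0) :
    ∃ L : Matrix (Fin n) (Fin m) ℍ[ℝ], L * X = 1 := by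
  refine ⟨mpInv X, sub_eq_zero.1 (h _ ?_)⟩
  rw [Matrix.mul_sub, ← Matrix.mul_assoc, (mpInv_spec X).mul_mul_left, Matrix.mul_one, sub_self]

theorem exists_full_rank_factorization (A : Matrix (Fin m) (Fin n) ℍ[ℝ]) :
    ∃ (X : Matrix (Fin m) (Fin (rank A)) ℍ[ℝ]) (Y : Matrix (Fin (rank A)) (Fin n) ℍ[ℝ]),
      A = X * Y ∧ (∃ L : Matrix (Fin (rank A)) (Fin m) ℍ[ℝ], L * X = 1) ∧
        ∃ R : Matrix (Fin n) (Fin (rank A)) ℍ[ℝ], Y * R = 1 := by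
  let S := Submodule.span (ℍ[ℝ])ᵐᵒᵖ (Set.range Aᵀ)
  let b : Module.Basis (Fin (rank A)) (ℍ[ℝ])ᵐᵒᵖ S := Module.finBasis (ℍ[ℝ])ᵐᵒᵖ S
  let X : Matrix (Fin m) (Fin (rank A)) ℍ[ℝ] := Matrix.of fun i j => (b j : Fin m → ℍ[ℝ]) i
  have hX : Submodule.span (ℍ[ℝ])ᵐᵒᵖ (Set.range Xᵀ) = S := by
    have hrange : Set.range Xᵀ = S.subtype '' Set.range b := by
      rw [← Set.range_comp]
      rfl
    rw [hrange, ← Submodule.map_span, b.span_eq, Submodule.map_top, Submodule.range_subtype]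
  have hcancel (C : Matrix (Fin (rank A)) (Fin (rank A)) ℍ[ℝ]) (hC : X * C = 0) : C = 0 := by
    ext1 l j
    have hsum : ∑ l, MulOpposite.op (C l j) • b l = 0 := by
      ext1
      ext1 i
      simpa [Matrix.mul_apply, X, Finset.sum_apply] using congrFun (congrFun hC i) j
    simpa using Fintype.linearIndependent_iff.1 b.linearIndependent _ hsum l
  obtain ⟨Y, hY⟩ := exists_mul_of_span_le hX.ge
  obtain ⟨R, hR⟩ := exists_mul_of_span_le hX.le
  refine ⟨X, Y, hY, exists_left_inverse_of_cancel hcancel, R, sub_eq_zero.1 (hcancel _ ?_)⟩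
  rw [Matrix.mul_sub, ← Matrix.mul_assoc, ← hY, ← hR, Matrix.mul_one, sub_self]

theorem rank_le_width (A : Matrix (Fin m) (Fin n) ℍ[ℝ]) : rank A ≤ n :=
  (finrank_range_le_card (R := (ℍ[ℝ])ᵐᵒᵖ) Aᵀ).trans_eq (Fintype.card_fin n)

theorem rank_mul_le_right (B : Matrix (Fin m) (Fin p) ℍ[ℝ]) (Z : Matrix (Fin p) (Fin n) ℍ[ℝ]) :
    rank (B * Z) ≤ rank Z := by
  obtain ⟨X, Y, hXY, -⟩ := exists_full_rank_factorization Z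
  calc rank (B * Z) = rank (B * X * Y) := by rw [Matrix.mul_assoc, ← hXY]
    _ ≤ rank (B * X) := rank_mul_le _ _
    _ ≤ rank Z := rank_le_width _

theorem rank_conjTranspose_mul_self (A : Matrix (Fin m) (Fin n) ℍ[ℝ]) :
    rank (Aᴴ * A) = rank A := by
  refine le_antisymm (rank_mul_le_right _ _) ?_
  have h := mpInv_spec A
  have hA : (mpInv A)ᴴ * (Aᴴ * A) = A := by
    rw [← Matrix.mul_assoc, ← Matrix.conjTranspose_mul, h.left_hermitian, h.mul_mul_left]
  conv_lhs => rw [← hA]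
  exact rank_mul_le_right _ _

/-- Over the noncommutative ring `ℍ[ℝ]` the trace itself is not cyclic. -/
theorem re_trace_mul_comm (X : Matrix (Fin m) (Fin n) ℍ[ℝ]) (Y : Matrix (Fin n) (Fin m) ℍ[ℝ]) :
    (X * Y).trace.re = (Y * X).trace.re := by
  have hre_mul (a b : ℍ[ℝ]) : (a * b).re = (b * a).re := by
    simp only [Quaternion.re_mul]
    ring
  have hre_sum {l : ℕ} (f : Fin l → ℍ[ℝ]) : (∑ i, f i).re = ∑ i, (f i).re :=
    map_sum (QuaternionAlgebra.reₗ (R := ℝ) (-1) 0 (-1)) f Finset.univ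
  simp only [Matrix.trace, Matrix.diag_apply, Matrix.mul_apply, hre_sum, hre_mul (X _ _)]
  exact Finset.sum_comm

theorem re_trace_of_isIdempotentElem {P : Matrix (Fin n) (Fin n) ℍ[ℝ]}
    (hP : IsIdempotentElem P) : P.trace.re = rank P := by
  obtain ⟨X, Y, hXY, ⟨L, hL⟩, R, hR⟩ := exists_full_rank_factorization P
  have hYX : Y * X = 1 :=
    calc Y * X = (L * X) * (Y * X) * (Y * R) := by rw [hL, hR, Matrix.one_mul, Matrix.mul_one]
      _ = L * ((X * Y) * (X * Y)) * R := by simp only [Matrix.mul_assoc]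
      _ = L * (X * Y) * R := by rw [← hXY, hP.eq]
      _ = (L * X) * (Y * R) := by simp only [Matrix.mul_assoc]
      _ = 1 := by rw [hL, hR, Matrix.mul_one]
  conv_lhs => rw [hXY]
  rw [re_trace_mul_comm, hYX]
  simp [Matrix.trace]

end RankTrace

/-! ### The Faddeev–LeVerrier recursion -/

section FaddeevLeVerrier

variable {n p : ℕ}

/-- The sum of the cofactor matrices of the principal submatrices of order `k`; for a Hermitian
matrix, the coefficient matrices of the adjugate of `t • 1 + M` as a polynomial in `t`. -/
noncomputable def adjSum (k : ℕ) (M : Matrix (Fin n) (Fin n) ℍ[ℝ]) :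
    Matrix (Fin n) (Fin n) ℍ[ℝ] :=
  ∑ β ∈ Finset.powersetCard k Finset.univ, cofactor M β

theorem cdetSum_eq_adjSum_mul (k : ℕ) (M : Matrix (Fin n) (Fin n) ℍ[ℝ])
    (B : Matrix (Fin n) (Fin p) ℍ[ℝ]) : cdetSum k M B = adjSum k M * B := by
  ext1 i j
  have hcdet (β : {β : Finset (Fin n) // β.card = k ∧ i ∈ β}) :
      cdet (principal (M.updateCol i fun l => B l j) β.1) ⟨i, β.2.2⟩ = (cofactor M β.1 * B) i j :=
    cdet_principal_updateCol M β.1 ⟨i, β.2.2⟩ _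
  simp only [cdetSum, Matrix.of_apply, hcdet]
  rw [← Finset.sum_subtype ({β ∈ Finset.powersetCard k Finset.univ | i ∈ β}) (by simp)
    fun β => (cofactor M β * B) i j, adjSum, Matrix.sum_mul, Matrix.sum_apply]
  refine Finset.sum_filter_of_ne fun β _ hβ => ?_
  by_contra hi
  exact hβ (cofactor_mul_apply_of_notMem M B hi j)

theorem minorSum_eq_sum (k : ℕ) (M : Matrix (Fin n) (Fin n) ℍ[ℝ]) :
    minorSum k M = ∑ β ∈ Finset.powersetCard k Finset.univ, principalMinor M β :=
  (Finset.sum_subtype _ (by simp) _).symm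

theorem minorSum_zero (M : Matrix (Fin n) (Fin n) ℍ[ℝ]) : minorSum 0 M = 1 := by
  simp [minorSum_eq_sum, principalMinor_empty]

theorem minorSum_of_lt {k : ℕ} (hk : n < k) (M : Matrix (Fin n) (Fin n) ℍ[ℝ]) :
    minorSum k M = 0 := by
  rw [minorSum_eq_sum, Finset.powersetCard_eq_empty.2 (by simpa using hk), Finset.sum_empty]

theorem adjSum_of_lt {k : ℕ} (hk : n < k) (M : Matrix (Fin n) (Fin n) ℍ[ℝ]) :
    adjSum k M = 0 := by
  rw [adjSum, Finset.powersetCard_eq_empty.2 (by simpa using hk), Finset.sum_empty]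

theorem adjSum_succ_apply (k : ℕ) (M : Matrix (Fin n) (Fin n) ℍ[ℝ]) (p s : Fin n) :
    adjSum (k + 1) M p s = ∑ β ∈ Finset.powersetCard k Finset.univ with s ∉ β,
      ((if p = s then principalMinor M β else 0) - (cofactor M β * M) p s) := by
  have hmem : adjSum (k + 1) M p s =
      ∑ γ ∈ Finset.powersetCard (k + 1) Finset.univ with s ∈ γ, cofactor M γ p s := by
    rw [adjSum, Matrix.sum_apply]
    refine (Finset.sum_filter_of_ne fun γ _ hγ => ?_).symm
    by_contra hs
    exact hγ (cofactor_apply_of_notMem_right M p hs)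
  rw [hmem]
  refine Finset.sum_nbij' (·.erase s) (insert s) ?_ ?_ ?_ ?_ fun γ hγ =>
    cofactor_apply_of_mem_right M p (Finset.mem_filter.1 hγ).2
  all_goals grind

variable {M : Matrix (Fin n) (Fin n) ℍ[ℝ]}

theorem minorSum_eq_coe_re (hM : M.IsHermitian) (k : ℕ) :
    minorSum k M = ((minorSum k M).re : ℝ) := by
  rw [← Quaternion.star_eq_self, minorSum_eq_sum, star_sum]
  exact Finset.sum_congr rfl fun β _ => isSelfAdjoint_principalMinor hM β

theorem re_minorSum_ne_zero (hM : M.IsHermitian) {k : ℕ} (h : minorSum k M ≠ 0) :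
    (minorSum k M).re ≠ 0 := fun hre => h (by rw [minorSum_eq_coe_re hM, hre, Quaternion.coe_zero])

theorem adjSum_mul_add_adjSum_succ (hM : M.IsHermitian) (k : ℕ) :
    adjSum k M * M + adjSum (k + 1) M = (minorSum k M).re • (1 : Matrix (Fin n) (Fin n) ℍ[ℝ]) := by
  ext1 p s
  have hminor : ((minorSum k M).re • (1 : Matrix (Fin n) (Fin n) ℍ[ℝ])) p s =
      ∑ β ∈ Finset.powersetCard k Finset.univ, if p = s then principalMinor M β else 0 := by
    rw [Matrix.smul_apply, Matrix.one_apply, smul_ite, smul_zero, ← Algebra.algebraMap_eq_smul_one]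
    split_ifs
    · exact (minorSum_eq_coe_re hM k).symm.trans (minorSum_eq_sum k M)
    · exact Finset.sum_const_zero.symm
  have hmem : ∑ β ∈ Finset.powersetCard k Finset.univ with s ∈ β, (cofactor M β * M) p s =
      ∑ β ∈ Finset.powersetCard k Finset.univ with s ∈ β,
        if p = s then principalMinor M β else 0 :=
    Finset.sum_congr rfl fun β hβ => cofactor_mul_apply_of_mem hM p (Finset.mem_filter.1 hβ).2
  rw [hminor, Matrix.add_apply, adjSum_succ_apply, adjSum, Matrix.sum_mul, Matrix.sum_apply,
    ← Finset.sum_filter_add_sum_filter_not _ (s ∈ ·) fun β => (cofactor M β * M) p s, hmem,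
    Finset.sum_sub_distrib, add_assoc, add_sub_cancel, Finset.sum_filter_add_sum_filter_not]

theorem trace_adjSum_mul (hM : M.IsHermitian) (k : ℕ) :
    (adjSum k M * M).trace = k • minorSum k M := by
  have htrace (β : Finset (Fin n)) : (cofactor M β * M).trace = β.card • principalMinor M β := by
    rw [Matrix.trace, ← Finset.sum_const]
    refine (Finset.sum_subset β.subset_univ fun s _ hs =>
      cofactor_mul_apply_of_notMem M M hs s).symm.trans ?_
    exact Finset.sum_congr rfl fun s hs => (cofactor_mul_apply_of_mem hM s hs).trans (if_pos rfl)
  rw [adjSum, Matrix.sum_mul, Matrix.trace_sum, minorSum_eq_sum, Finset.smul_sum]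
  refine Finset.sum_congr rfl fun β hβ => ?_
  rw [htrace, (Finset.mem_powersetCard.1 hβ).2]

theorem mul_mul_mpInv_of_isHermitian (hM : M.IsHermitian) : M * M * mpInv M = M := by
  have h := mpInv_spec M
  have hstar := congrArg Matrix.conjTranspose h.mul_mul_left
  rwa [Matrix.conjTranspose_mul, h.left_hermitian, hM.eq, ← Matrix.mul_assoc] at hstar

theorem adjSum_succ_mul_eq_zero (hM : M.IsHermitian) {a : ℕ}
    (ha : a ∈ upperBounds {k | minorSum k M ≠ 0}) : adjSum (a + 1) M * M = 0 := by
  have hrec (k : ℕ) (hk : a < k) : adjSum k M * M = -adjSum (k + 1) M := by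
    have hzero : minorSum k M = 0 := not_not.1 fun h => hk.not_ge (ha h)
    rw [eq_neg_iff_add_eq_zero, adjSum_mul_add_adjSum_succ hM, hzero, Quaternion.re_zero,
      zero_smul]
  have hpow (j : ℕ) : adjSum (a + 1) M * M ^ j = (-1) ^ j * adjSum (a + 1 + j) M := by
    induction j with
    | zero => simp
    | succ j ih =>
      rw [pow_succ, ← mul_assoc, ih, mul_assoc, hrec _ (by lia), mul_neg, pow_succ, mul_neg_one,
        neg_mul, ← add_assoc]
  have hM_eq : M = M ^ n * M * mpInv M ^ n := by
    have h := pow_eq_pow_add_mul_pow (v := M) (z := mpInv M) (a := 1)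
      (by simpa [pow_two] using (mul_mul_mpInv_of_isHermitian hM).symm) n
    rwa [pow_one, add_comm, pow_succ] at h
  nth_rewrite 2 [hM_eq]
  rw [← mul_assoc, ← mul_assoc, hpow, adjSum_of_lt (by lia)]
  simp only [mul_zero, zero_mul]

theorem adjSum_mul_mul (hM : M.IsHermitian) {a : ℕ} (ha : a ∈ upperBounds {k | minorSum k M ≠ 0}) :
    adjSum a M * (M * M) = (minorSum a M).re • M := by
  have hrec := congrArg (· * M) (adjSum_mul_add_adjSum_succ hM a)
  simpa only [Matrix.add_mul, adjSum_succ_mul_eq_zero hM ha, add_zero, Matrix.smul_mul,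
    Matrix.one_mul, Matrix.mul_assoc] using hrec

theorem rank_mul_mpInv (A : Matrix (Fin n) (Fin p) ℍ[ℝ]) : rank (A * mpInv A) = rank A := by
  refine le_antisymm (rank_mul_le _ _) ?_
  conv_lhs => rw [← (mpInv_spec A).mul_mul_left]
  exact rank_mul_le _ _

/-- By the Faddeev–LeVerrier recursion, `adjSum a M * M` is a multiple of the orthogonal projection
onto the column space of `M`, whose trace is the rank; comparing traces gives the claim. -/
theorem eq_rank_of_isGreatest (hM : M.IsHermitian) {a : ℕ}
    (ha : IsGreatest {k | minorSum k M ≠ 0} a) : a = rank M := by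
  have hproj : adjSum a M * M = (minorSum a M).re • (M * mpInv M) := by
    nth_rewrite 2 [← mul_mul_mpInv_of_isHermitian hM]
    rw [← Matrix.mul_assoc, adjSum_mul_mul hM ha.2, Matrix.smul_mul]
  have hidem : IsIdempotentElem (M * mpInv M) := by
    rw [IsIdempotentElem, ← mul_assoc, (mpInv_spec M).mul_mul_left]
  have htrace := congrArg (fun N => N.trace.re) hproj
  simp only [trace_adjSum_mul hM, Matrix.trace_smul, Quaternion.re_smul,
    ← Nat.cast_smul_eq_nsmul ℝ, re_trace_of_isIdempotentElem hidem, rank_mul_mpInv,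
    smul_eq_mul] at htrace
  rw [mul_comm] at htrace
  exact_mod_cast mul_left_cancel₀ (re_minorSum_ne_zero hM ha.1) htrace

theorem isGreatest_rank (hM : M.IsHermitian) : IsGreatest {k | minorSum k M ≠ 0} (rank M) := by
  have hne : {k | minorSum k M ≠ 0}.Nonempty := ⟨0, by simp [minorSum_zero]⟩
  have hbdd : BddAbove {k | minorSum k M ≠ 0} :=
    ⟨n, fun k hk => not_lt.1 fun h => hk (minorSum_of_lt h M)⟩
  have hsSup : IsGreatest {k | minorSum k M ≠ 0} (sSup {k | minorSum k M ≠ 0}) :=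
    ⟨Nat.sSup_mem hne hbdd, fun _ hk => le_csSup hbdd hk⟩
  exact eq_rank_of_isGreatest hM hsSup ▸ hsSup

theorem cdetSum_mul_mul (hM : M.IsHermitian) (Y : Matrix (Fin n) (Fin p) ℍ[ℝ]) :
    cdetSum (rank M) M (M * (M * Y)) = (minorSum (rank M) M).re • (M * Y) := by
  rw [cdetSum_eq_adjSum_mul, ← Matrix.mul_assoc M, ← Matrix.mul_assoc,
    adjSum_mul_mul hM (isGreatest_rank hM).2, Matrix.smul_mul]

end FaddeevLeVerrier

/-! ### Cramer's rules for generalized inverses -/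

section MoorePenrose

variable {m n p : ℕ} (B : Matrix (Fin m) (Fin n) ℍ[ℝ])

theorem minorSum_conjTranspose_mul_self_eq_coe_re :
    minorSum (rank B) (Bᴴ * B) = ((minorSum (rank B) (Bᴴ * B)).re : ℝ) :=
  minorSum_eq_coe_re (Matrix.isHermitian_conjTranspose_mul_self B) _

theorem re_minorSum_conjTranspose_mul_self_ne_zero :
    (minorSum (rank B) (Bᴴ * B)).re ≠ 0 := by
  have hH := Matrix.isHermitian_conjTranspose_mul_self B
  rw [← rank_conjTranspose_mul_self]
  exact re_minorSum_ne_zero hH (isGreatest_rank hH).1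

theorem cdetSum_conjTranspose_mul (C : Matrix (Fin m) (Fin p) ℍ[ℝ]) :
    cdetSum (rank B) (Bᴴ * B) (Bᴴ * C) = (minorSum (rank B) (Bᴴ * B)).re • (mpInv B * C) := by
  have h := mpInv_spec B
  have hnormal : Bᴴ * B * mpInv B = Bᴴ := by
    have hstar := congrArg Matrix.conjTranspose h.mul_mul_left
    rwa [Matrix.conjTranspose_mul, h.left_hermitian, ← Matrix.mul_assoc] at hstar
  have hrange : Bᴴ * B * (mpInv B * (mpInv B)ᴴ * mpInv B) = mpInv B := by
    rw [← Matrix.mul_assoc, ← Matrix.mul_assoc, hnormal, ← Matrix.conjTranspose_mul,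
      h.right_hermitian, h.mul_mul_right]
  have hcramer := cdetSum_mul_mul (Matrix.isHermitian_conjTranspose_mul_self B)
    (mpInv B * (mpInv B)ᴴ * mpInv B * C)
  rwa [rank_conjTranspose_mul_self, ← Matrix.mul_assoc _ _ C, hrange, ← Matrix.mul_assoc _ _ C,
    hnormal] at hcramer

end MoorePenrose

/-- `d` is the Drazin inverse of `v`, and `k` is an upper bound for the index of `v`. -/
structure IsDrazin {R : Type*} [Ring R] (v d : R) (k : ℕ) : Prop where
  pow_mul : v ^ (k + 1) * d = v ^ k
  comm : Commute v d
  mul_mul : d * v * d = d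

namespace IsDrazin

section Ring

variable {R : Type*} [Ring R] {v d : R} {k : ℕ}

theorem mono {l : ℕ} (h : IsDrazin v d k) (hkl : k ≤ l) : IsDrazin v d l := by
  obtain ⟨j, rfl⟩ := Nat.exists_eq_add_of_le' hkl
  refine ⟨?_, h.comm, h.mul_mul⟩
  rw [add_assoc, pow_add, mul_assoc, h.pow_mul, ← pow_add]

theorem pow_add_mul_pow (h : IsDrazin v d k) (j : ℕ) : v ^ (k + j) * d ^ j = v ^ k :=
  (pow_eq_pow_add_mul_pow h.pow_mul.symm j).symm

theorem pow_mul_pow_succ (h : IsDrazin v d k) (j : ℕ) : v ^ j * d ^ (j + 1) = d := by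
  induction j with
  | zero => simp
  | succ j ih =>
    calc v ^ (j + 1) * d ^ (j + 1 + 1) = v * (v ^ j * d ^ (j + 1)) * d := by
          simp only [pow_succ' v, pow_succ d (j + 1), mul_assoc]
      _ = d := by rw [ih, h.comm.eq, h.mul_mul]

theorem pow_mul_mul_pow (h : IsDrazin v d k) {x : R}
    (hx : v ^ (2 * k + 1) * x * v ^ (2 * k + 1) = v ^ (2 * k + 1)) : v ^ k * x * v ^ k = d := by
  have hright : v ^ (2 * k + 1) * d ^ (k + 1) = v ^ k := by
    rw [two_mul, add_assoc, h.pow_add_mul_pow]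
  have hleft : d ^ (k + 1) * v ^ (2 * k + 1) = v ^ k := by
    rw [← (h.comm.pow_pow _ _).eq, hright]
  calc v ^ k * x * v ^ k
      = d ^ (k + 1) * v ^ (2 * k + 1) * x * (v ^ (2 * k + 1) * d ^ (k + 1)) := by
        rw [hleft, hright]
    _ = d ^ (k + 1) * (v ^ (2 * k + 1) * x * v ^ (2 * k + 1)) * d ^ (k + 1) := by
        simp only [mul_assoc]
    _ = d := by rw [hx, hleft, h.pow_mul_pow_succ]

end Ring

variable {n p : ℕ} {V D : Matrix (Fin n) (Fin n) ℍ[ℝ]} {k : ℕ}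

theorem rank_pow_add (h : IsDrazin V D k) (j : ℕ) : rank (V ^ (k + j)) = rank (V ^ k) := by
  refine le_antisymm ?_ ?_
  · rw [pow_add]
    exact rank_mul_le _ _
  · rw [← h.pow_add_mul_pow j]
    exact rank_mul_le _ _

theorem rank_pow_two_mul_add_one (h : IsDrazin V D k) :
    rank (V ^ (2 * k + 1)) = rank (V ^ k) := by
  rw [two_mul, add_assoc, h.rank_pow_add]

theorem pow_mul_cdetSum (h : IsDrazin V D k) (C : Matrix (Fin n) (Fin p) ℍ[ℝ]) :
    V ^ k * cdetSum (rank (V ^ k)) ((V ^ (2 * k + 1))ᴴ * V ^ (2 * k + 1))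
        ((V ^ (2 * k + 1))ᴴ * (V ^ k * C)) =
      (minorSum (rank (V ^ k)) ((V ^ (2 * k + 1))ᴴ * V ^ (2 * k + 1))).re • (D * C) := by
  rw [← h.rank_pow_two_mul_add_one, cdetSum_conjTranspose_mul, Matrix.mul_smul,
    ← Matrix.mul_assoc, ← Matrix.mul_assoc, h.pow_mul_mul_pow (mpInv_spec _).mul_mul_left]

theorem pow_mul_cdetSum_cdetSum (h : IsDrazin V D k) {M : Matrix (Fin n) (Fin n) ℍ[ℝ]}
    (hM : M = (V ^ (2 * k + 1))ᴴ * V ^ (2 * k + 1)) :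
    V ^ k * cdetSum (rank (V ^ k)) M ((V ^ (2 * k + 1))ᴴ * V ^ (2 * k) *
        cdetSum (rank (V ^ k)) M ((V ^ (2 * k + 1))ᴴ * V ^ k) * V) =
      (minorSum (rank (V ^ k)) M).re ^ 2 • D := by
  have hinner := h.pow_mul_cdetSum (1 : Matrix (Fin n) (Fin n) ℍ[ℝ])
  simp only [Matrix.mul_one, ← hM] at hinner
  rw [two_mul k, pow_add V k k, Matrix.mul_assoc, Matrix.mul_assoc, Matrix.mul_assoc (V ^ k),
    ← Matrix.mul_assoc (V ^ k) (cdetSum _ _ _), ← two_mul, hinner, hM, h.pow_mul_cdetSum,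
    Matrix.smul_mul, Matrix.mul_smul, smul_smul, ← pow_two, ← h.comm.eq, ← mul_assoc, h.mul_mul]

theorem cdetSum_of_isHermitian (h : IsDrazin V D k) (hV : V.IsHermitian) :
    cdetSum (rank (V ^ k)) (V ^ (k + 2)) (V ^ (k + 1)) =
      (minorSum (rank (V ^ k)) (V ^ (k + 2))).re • D := by
  have hcramer := cdetSum_mul_mul (hV.pow (k + 2)) (D ^ (k + 3))
  rwa [h.rank_pow_add, h.pow_mul_pow_succ (k + 2), (h.mono k.le_succ).pow_mul] at hcramer

end IsDrazin

section Weighted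

variable {m n : ℕ} (A : Matrix (Fin m) (Fin n) ℍ[ℝ]) (W : Matrix (Fin n) (Fin m) ℍ[ℝ])

theorem isDrazin_wDrazinInv_mul : IsDrazin (A * W) (wDrazinInv A W * W) (index (A * W)) := by
  have h : IsWeightedDrazin A W (wDrazinInv A W) := (exists_isWeightedDrazin A W).choose_spec
  refine ⟨(Matrix.mul_assoc _ _ _).symm.trans h.pow_mul, ?_, ?_⟩
  · rw [Commute, SemiconjBy, ← Matrix.mul_assoc, h.comm, Matrix.mul_assoc (wDrazinInv A W * W)]
  · rw [← Matrix.mul_assoc (_ * W) A W, ← Matrix.mul_assoc _ _ W, h.mul_mul]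

theorem wmpdInv_apply_eq_div {c : ℝ} (hc : c ≠ 0) {U : Matrix (Fin m) (Fin m) ℍ[ℝ]}
    (hU : U = c • (A * W * (wDrazinInv A W * W))) (i : Fin n) (j : Fin m) :
    wmpdInv A W i j =
      cdetSum (rank A) (Aᴴ * A) (Aᴴ * U) i j / (minorSum (rank A) (Aᴴ * A) * c) := by
  have ha := re_minorSum_conjTranspose_mul_self_ne_zero A
  have hwmpd : wmpdInv A W = mpInv A * (A * W * (wDrazinInv A W * W)) := by
    simp only [wmpdInv, Matrix.mul_assoc]
  rw [minorSum_conjTranspose_mul_self_eq_coe_re, cdetSum_conjTranspose_mul, hU, Matrix.mul_smul,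
    smul_smul, ← hwmpd, Matrix.smul_apply, ← Quaternion.mul_coe_eq_smul, ← Quaternion.coe_mul,
    mul_div_cancel_right₀]
  exact (map_ne_zero (algebraMap ℝ ℍ[ℝ])).2 (mul_ne_zero ha hc)

end Weighted

end QMat

theorem theorem4p6_general {m n : ℕ} (A : Matrix (Fin m) (Fin n) ℍ[ℝ])
    (W : Matrix (Fin n) (Fin m) ℍ[ℝ]) (r r₁ k : ℕ) (hr : QMat.rank A = r)
    (hk : QMat.index (A * W) ≤ k) (hr₁ : QMat.rank ((A * W) ^ k) = r₁) :
    (∀ V M Ψ Υ : Matrix (Fin m) (Fin m) ℍ[ℝ],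
      V = A * W →
      M = (V ^ (2 * k + 1))ᴴ * V ^ (2 * k + 1) →
      Ψ = QMat.cdetSum r₁ M ((V ^ (2 * k + 1))ᴴ * V ^ k) →
      Υ = QMat.cdetSum r₁ M ((V ^ (2 * k + 1))ᴴ * V ^ (2 * k) * Ψ * A * W) →
      ∀ i j, QMat.wmpdInv A W i j =
        QMat.cdetSum r (Aᴴ * A) (Aᴴ * (A * W) ^ (k + 1) * Υ) i j /
          (QMat.minorSum r (Aᴴ * A) * QMat.minorSum r₁ M ^ 2)) ∧
    ((A * W).IsHermitian → ∀ Υ : Matrix (Fin m) (Fin m) ℍ[ℝ],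
      Υ = QMat.cdetSum r₁ ((A * W) ^ (k + 2)) ((A * W) ^ (k + 1)) →
      ∀ i j, QMat.wmpdInv A W i j =
        QMat.cdetSum r (Aᴴ * A) (Aᴴ * A * W * Υ) i j /
          (QMat.minorSum r (Aᴴ * A) * QMat.minorSum r₁ ((A * W) ^ (k + 2)))) := by
  subst hr hr₁
  have hD := (QMat.isDrazin_wDrazinInv_mul A W).mono hk
  constructor
  · rintro V M Ψ Υ rfl hM rfl hΥ i j
    have hrank := hD.rank_pow_two_mul_add_one
    have hc := QMat.re_minorSum_conjTranspose_mul_self_ne_zero ((A * W) ^ (2 * k + 1))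
    have hcoe := QMat.minorSum_conjTranspose_mul_self_eq_coe_re ((A * W) ^ (2 * k + 1))
    rw [hrank, ← hM] at hc hcoe
    rw [hcoe, ← Quaternion.coe_pow, Matrix.mul_assoc Aᴴ]
    refine QMat.wmpdInv_apply_eq_div A W (pow_ne_zero 2 hc) ?_ i j
    rw [hΥ, Matrix.mul_assoc _ A W, pow_succ', Matrix.mul_assoc (A * W),
      hD.pow_mul_cdetSum_cdetSum hM, Matrix.mul_smul]
  · rintro hV Υ rfl i j
    have hM := hV.pow (k + 2)
    have hc := QMat.re_minorSum_ne_zero hM (QMat.isGreatest_rank hM).1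
    rw [hD.rank_pow_add] at hc
    rw [QMat.minorSum_eq_coe_re hM, hD.cdetSum_of_isHermitian hV, Matrix.mul_assoc Aᴴ,
      Matrix.mul_assoc Aᴴ]
    exact QMat.wmpdInv_apply_eq_div A W hc (Matrix.mul_smul _ _ _) i j

theorem theorem4p6 {m n : ℕ} (A : Matrix (Fin m) (Fin n) ℍ[ℝ]) (W : Matrix (Fin n) (Fin m) ℍ[ℝ])
    (hW : W ≠ 0) (r r₁ k : ℕ) (hr : QMat.rank A = r)
    (hk : k = max (QMat.index (W * A)) (QMat.index (A * W)))
    (hr₁ : QMat.rank ((A * W) ^ k) = r₁) :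
    -- (i) `A * W` arbitrary
    (∀ V M Ψ Υ : Matrix (Fin m) (Fin m) ℍ[ℝ],
      V = A * W →
      M = (V ^ (2 * k + 1))ᴴ * V ^ (2 * k + 1) →
      Ψ = QMat.cdetSum r₁ M ((V ^ (2 * k + 1))ᴴ * V ^ k) →
      Υ = QMat.cdetSum r₁ M ((V ^ (2 * k + 1))ᴴ * V ^ (2 * k) * Ψ * A * W) →
      ∀ i j, QMat.wmpdInv A W i j =
        QMat.cdetSum r (Aᴴ * A) (Aᴴ * (A * W) ^ (k + 1) * Υ) i j /
          (QMat.minorSum r (Aᴴ * A) * QMat.minorSum r₁ M ^ 2)) ∧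
    -- (ii) `A * W` Hermitian
    ((A * W).IsHermitian → ∀ Υ : Matrix (Fin m) (Fin m) ℍ[ℝ],
      Υ = QMat.cdetSum r₁ ((A * W) ^ (k + 2)) ((A * W) ^ (k + 1)) →
      ∀ i j, QMat.wmpdInv A W i j =
        QMat.cdetSum r (Aᴴ * A) (Aᴴ * A * W * Υ) i j /
          (QMat.minorSum r (Aᴴ * A) * QMat.minorSum r₁ ((A * W) ^ (k + 2)))) :=
  theorem4p6_general A W r r₁ k hr (hk ▸ le_max_right _ _) hr₁
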